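/- Let $k$ be a field and $\mathrm{Vect}$ the category of $k$-vector spaces. The Hom-category $\mathcal H(\mathrm{Vect})$ has as objects the pairs $(X,f_X)$ with $X$ a vector space and $f_X$ a linear automorphism of $X$; a morphism $(X,f_X)\to(Y,f_Y)$ is a linear map $\xi:X\to Y$ with $f_Y\xi=\xi f_X$. A monoidal structure on $\mathcal H(\mathrm{Vect})$ is *induced from* $\mathrm{Vect}$ if the tensor product of $(X,f_X)$ and $(Y,f_Y)$ is $X\otimes Y$ with some automorphism $f_{X\otimes Y}$, the tensor product of morphisms is that of linear maps, and the unit object is $k$ with some automorphism $f_k$; the associativity and unit constraints are arbitrary natural isomorphisms of $\mathcal H(\mathrm{Vect})$ satisfying the pentagon and triangle axioms. A monoidal functor is *strict* if its structure isomorphisms are identities. For $(q,a,b)\in k^\times\times\mathbb Z\times\mathbb Z$ let $\mathcal H^{a,b}_q(\mathrm{Vect})$ be $\mathcal H(\mathrm{Vect})$ with tensor product $(X\otimes Y,f_X\otimes f_Y)$, unit object $(k,\mathrm{Id}_k)$, associativity constraint $(x\otimes y)\otimes z\mapsto f_X^a(x)\otimes(y\otimes f_Z^b(z))$, and unit constraints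 $\kappa\otimes x\mapsto \kappa q f_X^{-b}(x)$ and $x\otimes\kappa\mapsto\kappa q f_X^{a}(x)$. Let $k[\langle g\rangle]$ be the group algebra of the infinite cyclic group, and $k[\langle g\rangle]^{a,b}_q$ the triangular quasi-bialgebra on it with $\Delta(g)=g\otimes g$, $\varepsilon(g)=1$, reassociator $\phi=g^a\otimes1\otimes g^b$, unit elements $\lambda=qg^{-b}$, $\rho=qg^a$, and $R=g^{a+b}\otimes g^{-a-b}$. Its left modules form a symmetric monoidal category, with $h(x\otimes y)=\Delta(h)(x\otimes y)$, unit object $k$ with action $h\kappa=\varepsilon(h)\kappa$, and constraints $(x\otimes y)\otimes z\mapsto\phi^1x\otimes(\phi^2y\otimes\phi^3z)$, $\kappa\otimes x\mapsto\kappa\lambda x$, $x\otimes\kappa\mapsto\kappa\rho x$ and $x\otimes y\mapsto R^2y\otimes R^1x$. Let $W:(X,\mu_X)\mapsto(X,\,x\mapsto gx)$, $\xi\mapsto\xi$, be the functor from left $k[\langle g\rangle]$-modules to $\mathcal H(\mathrm{Vect})$. **Theorem.** 1. Each $\mathcal H^{a,b}_q(\mathrm{Vect})$ is a monoidal structure on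 $\mathcal H(\mathrm{Vect})$ induced from $\mathrm{Vect}$. Conversely, for each induced monoidal structure there are $q\in k^\times$ and $a,b\in\mathbb Z$ and a strict monoidal isomorphism of categories from it to $\mathcal H^{a,b}_q(\mathrm{Vect})$ that is the identity on underlying vector spaces and linear maps. If moreover the unit object of the structure is $(k,\mathrm{Id}_k)$, then the structure is equal to $\mathcal H^{a,b}_q(\mathrm{Vect})$ for exactly one triple $(q,a,b)$. 2. For all $(q,a,b)\in k^\times\times\mathbb Z\times\mathbb Z$ the monoidal category $\mathcal H^{a,b}_q(\mathrm{Vect})$ has exactly one braiding. This braiding is symmetric, and is given by $c(x\otimes y)=f_Y^{-a-b}(y)\otimes f_X^{a+b}(x)$ for $x\in X$, $y\in Y$. 3. For all $(q,a,b)$, $W$ is an isomorphism of categories, and it is a strict symmetric monoidal functor from the left modules over $k[\langle g\rangle]^{a,b}_q$ to $\mathcal H^{a,b}_q(\mathrm{Vect})$. -/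

import Mathlib

open CategoryTheory MonoidalCategory TensorProduct

universe u v w

/-- An object of the Hom-category `H(C)`: an object of `C` with an automorphism of it. -/
structure HomCat (C : Type u) [Category.{v} C] where
  obj : C
  aut : obj ≅ obj

namespace HomCat

variable {C : Type u} [Category.{v} C]

/-- A morphism `(M, f_M) ⟶ (N, f_N)`: a morphism `ξ : M ⟶ N` with `f_N ∘ ξ = ξ ∘ f_M`. -/
@[ext]
structure Hom (X Y : HomCat C) where
  hom : X.obj ⟶ Y.obj
  comm : X.aut.hom ≫ hom = hom ≫ Y.aut.hom

instance : Category (HomCat C) where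
  Hom := Hom
  id X := ⟨𝟙 _, by simp⟩
  comp f g := ⟨f.hom ≫ g.hom, by
    rw [← Category.assoc, f.comm, Category.assoc, g.comm, Category.assoc]⟩
  id_comp f := Hom.ext (Category.id_comp f.hom)
  comp_id f := Hom.ext (Category.comp_id f.hom)
  assoc f g h := Hom.ext (Category.assoc f.hom g.hom h.hom)

@[ext]
theorem hom_ext {X Y : HomCat C} {f g : X ⟶ Y} (h : f.hom = g.hom) : f = g := Hom.ext h

@[simp] theorem id_hom (X : HomCat C) : Hom.hom (𝟙 X) = 𝟙 X.obj := rfl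

@[simp] theorem comp_hom {X Y Z : HomCat C} (f : X ⟶ Y) (g : Y ⟶ Z) :
    (f ≫ g).hom = f.hom ≫ g.hom := rfl

/-- The forgetful functor `H(C) ⥤ C`. -/
@[simps]
def forget (C : Type u) [Category.{v} C] : HomCat C ⥤ C where
  obj X := X.obj
  map f := f.hom

/-- An isomorphism of `C` compatible with the automorphisms is an isomorphism of `H(C)`. -/
@[simps]
def mkIso {X Y : HomCat C} (e : X.obj ≅ Y.obj) (h : X.aut.hom ≫ e.hom = e.hom ≫ Y.aut.hom) :
    X ≅ Y where
  hom := ⟨e.hom, h⟩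
  inv := ⟨e.inv, by rw [Iso.eq_inv_comp, ← Category.assoc, ← h, Category.assoc]; simp⟩
  hom_inv_id := by ext; simp
  inv_hom_id := by ext; simp

end HomCat

/-- A lift of the tensor product and of the unit of `C` to `H(C)`: an automorphism of `X ⊗ Y` for
all objects `(X, f_X)`, `(Y, f_Y)` of `H(C)`, such that tensor products of morphisms of `H(C)` are
morphisms of `H(C)`, and an automorphism of the unit object. -/
structure InducedTensor (C : Type u) [Category.{v} C] [MonoidalCategory C] where
  tensorAut : ∀ X Y : HomCat C, X.obj ⊗ Y.obj ≅ X.obj ⊗ Y.obj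
  tensor_comm : ∀ {X X' Y Y' : HomCat C} (f : X ⟶ X') (g : Y ⟶ Y'),
    (tensorAut X Y).hom ≫ (f.hom ⊗ₘ g.hom) = (f.hom ⊗ₘ g.hom) ≫ (tensorAut X' Y').hom
  unitAut : 𝟙_ C ≅ 𝟙_ C

namespace InducedTensor

variable {C : Type u} [Category.{v} C] [MonoidalCategory C] (T : InducedTensor C)

abbrev tensorObj (X Y : HomCat C) : HomCat C := ⟨X.obj ⊗ Y.obj, T.tensorAut X Y⟩

abbrev unitObj : HomCat C := ⟨𝟙_ C, T.unitAut⟩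

abbrev tensorHom {X X' Y Y' : HomCat C} (f : X ⟶ X') (g : Y ⟶ Y') :
    T.tensorObj X Y ⟶ T.tensorObj X' Y' := ⟨f.hom ⊗ₘ g.hom, T.tensor_comm f g⟩

end InducedTensor

/-- A monoidal structure on `H(C)` induced by the monoidal structure of `C`: tensor product of
objects and morphisms and the unit object are those of `C`, while the constraints are arbitrary
natural isomorphisms in `H(C)` satisfying the pentagon and the triangle axioms. -/
structure InducedMonoidal (C : Type u) [Category.{v} C] [MonoidalCategory C] extends
    InducedTensor C where
  associator : ∀ X Y Z : HomCat C,
    toInducedTensor.tensorObj (toInducedTensor.tensorObj X Y) Z ≅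
      toInducedTensor.tensorObj X (toInducedTensor.tensorObj Y Z)
  leftUnitor : ∀ X : HomCat C, toInducedTensor.tensorObj toInducedTensor.unitObj X ≅ X
  rightUnitor : ∀ X : HomCat C, toInducedTensor.tensorObj X toInducedTensor.unitObj ≅ X
  associator_naturality : ∀ {X X' Y Y' Z Z' : HomCat C} (f : X ⟶ X') (g : Y ⟶ Y') (h : Z ⟶ Z'),
    toInducedTensor.tensorHom (toInducedTensor.tensorHom f g) h ≫ (associator X' Y' Z').hom =
      (associator X Y Z).hom ≫ toInducedTensor.tensorHom f (toInducedTensor.tensorHom g h)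
  leftUnitor_naturality : ∀ {X X' : HomCat C} (f : X ⟶ X'),
    toInducedTensor.tensorHom (𝟙 _) f ≫ (leftUnitor X').hom = (leftUnitor X).hom ≫ f
  rightUnitor_naturality : ∀ {X X' : HomCat C} (f : X ⟶ X'),
    toInducedTensor.tensorHom f (𝟙 _) ≫ (rightUnitor X').hom = (rightUnitor X).hom ≫ f
  pentagon : ∀ U V W X : HomCat C,
    toInducedTensor.tensorHom (associator U V W).hom (𝟙 X) ≫
        (associator U (toInducedTensor.tensorObj V W) X).hom ≫
          toInducedTensor.tensorHom (𝟙 U) (associator V W X).hom =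
      (associator (toInducedTensor.tensorObj U V) W X).hom ≫
        (associator U V (toInducedTensor.tensorObj W X)).hom
  triangle : ∀ V W : HomCat C,
    (associator V toInducedTensor.unitObj W).hom ≫
        toInducedTensor.tensorHom (𝟙 V) (leftUnitor W).hom =
      toInducedTensor.tensorHom (rightUnitor V).hom (𝟙 W)

/-- The monoidal category given by an induced monoidal structure on `H(C)`. -/
@[reducible]
def InducedMonoidal.monoidalCategory {C : Type u} [Category.{v} C] [MonoidalCategory C]
    (S : InducedMonoidal C) : MonoidalCategory (HomCat C) :=
  letI : MonoidalCategoryStruct (HomCat C) :=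
    { tensorObj := S.tensorObj
      tensorUnit := S.unitObj
      tensorHom := S.tensorHom
      whiskerLeft := fun X _ _ g => S.tensorHom (𝟙 X) g
      whiskerRight := fun f Y => S.tensorHom f (𝟙 Y)
      associator := S.associator
      leftUnitor := S.leftUnitor
      rightUnitor := S.rightUnitor }
  MonoidalCategory.ofTensorHom
    (id_tensorHom_id := fun X Y => by
      ext; exact MonoidalCategory.id_tensorHom_id X.obj Y.obj)
    (id_tensorHom := fun _ _ _ _ => rfl)
    (tensorHom_id := fun _ _ => rfl)
    (tensorHom_comp_tensorHom := fun f g h i => by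
      ext; exact MonoidalCategory.tensorHom_comp_tensorHom f.hom g.hom h.hom i.hom)
    (associator_naturality := S.associator_naturality)
    (leftUnitor_naturality := S.leftUnitor_naturality)
    (rightUnitor_naturality := S.rightUnitor_naturality)
    (pentagon := S.pentagon)
    (triangle := S.triangle)

/-- A functor `F` is an isomorphism of categories. -/
def IsCategoryIso {C : Type u} [Category.{v} C] {D : Type w} [Category.{v} D] (F : C ⥤ D) : Prop :=
  ∃ G : D ⥤ C, F ⋙ G = 𝟭 C ∧ G ⋙ F = 𝟭 D

/-- `F` is a strict monoidal functor: it preserves tensor products and the unit object on the nose,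
and is a monoidal functor with structure morphisms the identities. -/
def IsStrictMonoidal {C : Type u} [Category.{v} C] (mC : MonoidalCategory C)
    {D : Type w} [Category.{v} D] (mD : MonoidalCategory D) (F : C ⥤ D) : Prop :=
  ∃ m : F.Monoidal,
    (∃ h : 𝟙_ D = F.obj (𝟙_ C), m.ε = eqToHom h) ∧
    ∀ X Y : C, ∃ h : F.obj X ⊗ F.obj Y = F.obj (X ⊗ Y), m.μ X Y = eqToHom h

/-- `F` is a strict symmetric monoidal functor: a strict monoidal functor which is compatible with
the symmetries, for the (identity) monoidal functor structure. -/
def IsStrictSymmetric {C : Type u} [Category.{v} C] {mC : MonoidalCategory C}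
    (sC : SymmetricCategory C) {D : Type w} [Category.{v} D] {mD : MonoidalCategory D}
    (sD : SymmetricCategory D) (F : C ⥤ D) : Prop :=
  ∃ m : F.Braided,
    (∃ h : 𝟙_ D = F.obj (𝟙_ C), m.ε = eqToHom h) ∧
    ∀ X Y : C, ∃ h : F.obj X ⊗ F.obj Y = F.obj (X ⊗ Y), m.μ X Y = eqToHom h

/-- Two induced monoidal structures on `H(C)` are isomorphic: there is a strict monoidal
isomorphism between the corresponding monoidal categories, which is the identity on underlying
objects and morphisms of `C`. -/
def InducedMonoidal.Isomorphic {C : Type u} [Category.{v} C] [MonoidalCategory C]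
    (S T : InducedMonoidal C) : Prop :=
  ∃ F : HomCat C ⥤ HomCat C,
    IsCategoryIso F ∧ F ⋙ HomCat.forget C = HomCat.forget C ∧
      IsStrictMonoidal S.monoidalCategory T.monoidalCategory F

section HomStructures

variable {k : Type u} [Field k]

namespace HomCat

/-- The linear automorphism `f_X ^ n`, for `n : ℤ`, of the object `(X, f_X)` of `H(Vect)`. -/
noncomputable def pow (X : HomCat (ModuleCat.{u} k)) (n : ℤ) : X.obj ≃ₗ[k] X.obj :=
  X.aut.toLinearEquiv ^ n

@[simp] theorem pow_zero_apply (X : HomCat (ModuleCat.{u} k)) (x : X.obj) : X.pow 0 x = x := by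
  simp [pow]

theorem pow_one_apply (X : HomCat (ModuleCat.{u} k)) (x : X.obj) : X.pow 1 x = X.aut.hom x := by
  simp [pow]

theorem pow_add_apply (X : HomCat (ModuleCat.{u} k)) (m n : ℤ) (x : X.obj) :
    X.pow (m + n) x = X.pow m (X.pow n x) := by
  simp [pow, zpow_add]

theorem pow_comm_apply (X : HomCat (ModuleCat.{u} k)) (m n : ℤ) (x : X.obj) :
    X.pow m (X.pow n x) = X.pow n (X.pow m x) := by
  rw [← pow_add_apply, ← pow_add_apply, add_comm]

/-- An identity for the first power propagates to all integer powers. -/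
theorem map_pow_of_map_one {X Y : HomCat (ModuleCat.{u} k)} (f : X.obj →ₗ[k] Y.obj)
    (h : ∀ x, f (X.pow 1 x) = Y.pow 1 (f x)) (n : ℤ) (x : X.obj) :
    f (X.pow n x) = Y.pow n (f x) := by
  have h' : ∀ x, f (X.pow (-1) x) = Y.pow (-1) (f x) := fun x => by
    apply (Y.pow 1).injective
    rw [← h, ← pow_add_apply, ← pow_add_apply]
    simp
  induction n generalizing x with
  | zero => rw [pow_zero_apply, pow_zero_apply]
  | succ n ih => rw [pow_add_apply, ih, h, ← pow_add_apply]
  | pred n ih => rw [sub_eq_add_neg, pow_add_apply, ih, h', ← pow_add_apply]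

theorem hom_pow_apply {X Y : HomCat (ModuleCat.{u} k)} (f : X ⟶ Y) (n : ℤ) (x : X.obj) :
    f.hom (X.pow n x) = Y.pow n (f.hom x) := by
  refine map_pow_of_map_one f.hom.hom (fun x => ?_) n x
  rw [pow_one_apply, pow_one_apply]
  exact ConcreteCategory.congr_hom f.comm x

end HomCat

/-- The tensor product `(X ⊗ Y, f_X ⊗ f_Y)` and the unit object `(1, id)` of `H(C)`. -/
def diagonalTensor (C : Type u) [Category.{v} C] [MonoidalCategory C] : InducedTensor C where
  tensorAut X Y := X.aut ⊗ᵢ Y.aut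
  tensor_comm f g := by
    simp only [tensorIso_hom, MonoidalCategory.tensorHom_comp_tensorHom, f.comm, g.comm]
  unitAut := Iso.refl _

theorem diagonalTensor_pow_tmul (X Y : HomCat (ModuleCat.{u} k)) (n : ℤ) (x : X.obj) (y : Y.obj) :
    ((diagonalTensor _).tensorObj X Y).pow n (x ⊗ₜ[k] y : (X.obj ⊗ Y.obj : ModuleCat k)) =
      X.pow n x ⊗ₜ[k] Y.pow n y := by
  have h1 : ∀ (x : X.obj) (y : Y.obj), ((diagonalTensor _).tensorObj X Y).pow 1
      (x ⊗ₜ[k] y : (X.obj ⊗ Y.obj : ModuleCat k)) = X.pow 1 x ⊗ₜ[k] Y.pow 1 y := fun x y => by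
    rw [HomCat.pow_one_apply, HomCat.pow_one_apply, HomCat.pow_one_apply]; rfl
  have h' : ∀ (x : X.obj) (y : Y.obj), ((diagonalTensor _).tensorObj X Y).pow (-1)
      (x ⊗ₜ[k] y : (X.obj ⊗ Y.obj : ModuleCat k)) = X.pow (-1) x ⊗ₜ[k] Y.pow (-1) y :=
    fun x y => by
      apply (((diagonalTensor _).tensorObj X Y).pow 1).injective
      rw [h1, ← HomCat.pow_add_apply, ← HomCat.pow_add_apply, ← HomCat.pow_add_apply]
      rw [add_neg_cancel, HomCat.pow_zero_apply, HomCat.pow_zero_apply, HomCat.pow_zero_apply]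
  induction n generalizing x y with
  | zero => rw [HomCat.pow_zero_apply, HomCat.pow_zero_apply, HomCat.pow_zero_apply]
  | succ n ih =>
    rw [HomCat.pow_add_apply, h1, ih, ← HomCat.pow_add_apply, ← HomCat.pow_add_apply]
  | pred n ih =>
    rw [sub_eq_add_neg, HomCat.pow_add_apply, h', ih, ← HomCat.pow_add_apply,
      ← HomCat.pow_add_apply]

end HomStructures

/-- The induced monoidal structure `H^{a,b}_q(Vect)` on `H(Vect)`. -/
noncomputable def homStructure (k : Type u) [Field k] (q : kˣ) (a b : ℤ) :
    InducedMonoidal (ModuleCat.{u} k) where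
  toInducedTensor := diagonalTensor (ModuleCat.{u} k)
  associator X Y Z := HomCat.mkIso
    -- `(x ⊗ y) ⊗ z ↦ f_X^a x ⊗ (y ⊗ f_Z^b z)`
    ((TensorProduct.assoc k X.obj Y.obj Z.obj ≪≫ₗ
      TensorProduct.congr (X.pow a) (TensorProduct.congr (LinearEquiv.refl k Y.obj)
        (Z.pow b))).toModuleIso)
    (by
      apply ModuleCat.MonoidalCategory.tensor_ext₃'
      intro x y z
      change X.pow a (X.aut.hom x) ⊗ₜ[k] (Y.aut.hom y ⊗ₜ[k] Z.pow b (Z.aut.hom z)) =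
        X.aut.hom (X.pow a x) ⊗ₜ[k] (Y.aut.hom y ⊗ₜ[k] Z.aut.hom (Z.pow b z))
      simp only [← HomCat.pow_one_apply]
      rw [HomCat.pow_comm_apply X, HomCat.pow_comm_apply Z])
  leftUnitor X := HomCat.mkIso
    -- `κ ⊗ x ↦ κ q f_X^{-b} x`
    ((TensorProduct.lid k X.obj ≪≫ₗ X.pow (-b) ≪≫ₗ LinearEquiv.smulOfUnit q).toModuleIso)
    (by
      apply ModuleCat.MonoidalCategory.tensor_ext
      intro c x
      change (q : k) • X.pow (-b) ((c : k) • X.aut.hom x) =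
        X.aut.hom ((q : k) • X.pow (-b) ((c : k) • x))
      simp only [← HomCat.pow_one_apply, map_smul]
      rw [HomCat.pow_comm_apply])
  rightUnitor X := HomCat.mkIso
    -- `x ⊗ κ ↦ κ q f_X^a x`
    ((TensorProduct.rid k X.obj ≪≫ₗ X.pow a ≪≫ₗ LinearEquiv.smulOfUnit q).toModuleIso)
    (by
      apply ModuleCat.MonoidalCategory.tensor_ext
      intro x c
      change (q : k) • X.pow a ((c : k) • X.aut.hom x) =
        X.aut.hom ((q : k) • X.pow a ((c : k) • x))
      simp only [← HomCat.pow_one_apply, map_smul]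
      rw [HomCat.pow_comm_apply])
  associator_naturality {X X' Y Y' Z Z'} f g h := by
    apply HomCat.hom_ext
    apply ModuleCat.MonoidalCategory.tensor_ext₃'
    intro x y z
    change X'.pow a (f.hom x) ⊗ₜ[k] (g.hom y ⊗ₜ[k] Z'.pow b (h.hom z)) =
      f.hom (X.pow a x) ⊗ₜ[k] (g.hom y ⊗ₜ[k] h.hom (Z.pow b z))
    rw [HomCat.hom_pow_apply, HomCat.hom_pow_apply]
  leftUnitor_naturality {X X'} f := by
    apply HomCat.hom_ext
    apply ModuleCat.MonoidalCategory.tensor_ext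
    intro c x
    change (q : k) • X'.pow (-b) ((c : k) • f.hom x) = f.hom ((q : k) • X.pow (-b) ((c : k) • x))
    simp only [map_smul]
    rw [HomCat.hom_pow_apply]
  rightUnitor_naturality {X X'} f := by
    apply HomCat.hom_ext
    apply ModuleCat.MonoidalCategory.tensor_ext
    intro x c
    change (q : k) • X'.pow a ((c : k) • f.hom x) = f.hom ((q : k) • X.pow a ((c : k) • x))
    simp only [map_smul]
    rw [HomCat.hom_pow_apply]
  pentagon U V W X := by
    apply HomCat.hom_ext
    apply ModuleCat.hom_ext
    apply TensorProduct.ext_fourfold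
    intro u v w x
    change U.pow a (U.pow a u) ⊗ₜ[k] (V.pow a v ⊗ₜ[k] (W.pow b w ⊗ₜ[k] X.pow b (X.pow b x))) =
      TensorProduct.congr (U.pow a) (TensorProduct.congr (LinearEquiv.refl k V.obj)
        (((diagonalTensor _).tensorObj W X).pow b)) (TensorProduct.assoc k _ _ _
          ((((diagonalTensor _).tensorObj U V).pow a
            (u ⊗ₜ[k] v : (U.obj ⊗ V.obj : ModuleCat k))) ⊗ₜ[k] (w ⊗ₜ[k] X.pow b x)))
    rw [diagonalTensor_pow_tmul]
    change _ = U.pow a (U.pow a u) ⊗ₜ[k] (V.pow a v ⊗ₜ[k]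
      (((diagonalTensor _).tensorObj W X).pow b
        (w ⊗ₜ[k] X.pow b x : (W.obj ⊗ X.obj : ModuleCat k))))
    rw [diagonalTensor_pow_tmul]
  triangle V W := by
    apply HomCat.hom_ext
    apply ModuleCat.MonoidalCategory.tensor_ext₃'
    intro x c y
    change V.pow a x ⊗ₜ[k] ((q : k) • W.pow (-b) ((c : k) • W.pow b y)) = 
      ((q : k) • V.pow a ((c : k) • x)) ⊗ₜ[k] y
    simp only [map_smul, ← HomCat.pow_add_apply, neg_add_cancel, HomCat.pow_zero_apply,
      TensorProduct.smul_tmul]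
    rw [smul_comm]

theorem homStructure_associator_apply (k : Type u) [Field k] (q : kˣ) (a b : ℤ)
    (X Y Z : HomCat (ModuleCat.{u} k)) (x : X.obj) (y : Y.obj) (z : Z.obj) :
    ((homStructure k q a b).associator X Y Z).hom.hom ((x ⊗ₜ[k] y) ⊗ₜ[k] z) =
      X.pow a x ⊗ₜ[k] (y ⊗ₜ[k] Z.pow b z) := rfl

theorem homStructure_leftUnitor_apply (k : Type u) [Field k] (q : kˣ) (a b : ℤ)
    (X : HomCat (ModuleCat.{u} k)) (c : k) (x : X.obj) :
    ((homStructure k q a b).leftUnitor X).hom.hom (c ⊗ₜ[k] x) =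
      (c * (q : k)) • X.pow (-b) x := by
  change (q : k) • X.pow (-b) (c • x) = _
  rw [map_smul, smul_smul, mul_comm]

theorem homStructure_rightUnitor_apply (k : Type u) [Field k] (q : kˣ) (a b : ℤ)
    (X : HomCat (ModuleCat.{u} k)) (x : X.obj) (c : k) :
    ((homStructure k q a b).rightUnitor X).hom.hom (x ⊗ₜ[k] c) =
      (c * (q : k)) • X.pow a x := by
  change (q : k) • X.pow a (c • x) = _
  rw [map_smul, smul_smul, mul_comm]

section TensorActions

variable {k : Type u} [CommRing k]

/-- The action of `A ⊗ B` on `M ⊗ N` defined by actions of `A` on `M` and of `B` on `N`. -/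
noncomputable def actTensor {A B M N : Type*} [Ring A] [Algebra k A] [Ring B] [Algebra k B]
    [AddCommGroup M] [Module k M] [AddCommGroup N] [Module k N]
    (α : A →ₐ[k] Module.End k M) (β : B →ₐ[k] Module.End k N) :
    A ⊗[k] B →ₐ[k] Module.End k (M ⊗[k] N) :=
  (Module.endTensorEndAlgHom (R := k) (S := k) (A := k)).comp (Algebra.TensorProduct.map α β)

/-- The linear automorphism given by the action of a unit. -/
noncomputable def actUnit {A M : Type*} [Ring A] [Algebra k A] [AddCommGroup M] [Module k M]
    (α : A →ₐ[k] Module.End k M) (a : Aˣ) : M ≃ₗ[k] M :=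
  LinearMap.GeneralLinearGroup.generalLinearEquiv k M (Units.map α.toMonoidHom a)

section

variable {A B C D A' B' M N P Q M' N' : Type*}
  [Ring A] [Algebra k A] [Ring B] [Algebra k B] [Ring C] [Algebra k C] [Ring D] [Algebra k D]
  [Ring A'] [Algebra k A'] [Ring B'] [Algebra k B']
  [AddCommGroup M] [Module k M] [AddCommGroup N] [Module k N]
  [AddCommGroup P] [Module k P] [AddCommGroup Q] [Module k Q]
  [AddCommGroup M'] [Module k M'] [AddCommGroup N'] [Module k N']
  (α : A →ₐ[k] Module.End k M) (β : B →ₐ[k] Module.End k N) (γ : C →ₐ[k] Module.End k P)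
  (α' : A' →ₐ[k] Module.End k M') (β' : B' →ₐ[k] Module.End k N')

@[simp] theorem actUnit_apply (a : Aˣ) (m : M) : actUnit α a m = α a m := rfl

@[simp] theorem actUnit_symm_apply (a : Aˣ) (m : M) : (actUnit α a).symm m = α ↑a⁻¹ m := rfl

@[simp] theorem actTensor_tmul_tmul (a : A) (b : B) (m : M) (n : N) :
    actTensor α β (a ⊗ₜ b) (m ⊗ₜ n) = α a m ⊗ₜ β b n := rfl

theorem actTensor_map (f : M →ₗ[k] M') (g : N →ₗ[k] N') (p : A →ₐ[k] A') (q : B →ₐ[k] B')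
    (hf : ∀ a m, f (α a m) = α' (p a) (f m)) (hg : ∀ b n, g (β b n) = β' (q b) (g n))
    (t : A ⊗[k] B) (m : M ⊗[k] N) :
    TensorProduct.map f g (actTensor α β t m) =
      actTensor α' β' (Algebra.TensorProduct.map p q t) (TensorProduct.map f g m) := by
  induction t with
  | zero => simp
  | add s t hs ht => simp [hs, ht]
  | tmul a b =>
    induction m with
    | zero => simp
    | add m n hm hn => simp only [map_add, hm, hn]
    | tmul m n => simp [hf, hg]

theorem actTensor_comp (p : A' →ₐ[k] A) (q : B' →ₐ[k] B) (t : A' ⊗[k] B') :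
    actTensor (α.comp p) (β.comp q) t = actTensor α β (Algebra.TensorProduct.map p q t) := by
  induction t with
  | zero => simp
  | add s t hs ht => simp [hs, ht]
  | tmul a b => rfl

theorem actTensor_comp_left (p : A' →ₐ[k] A) (t : A' ⊗[k] B) :
    actTensor (α.comp p) β t =
      actTensor α β (Algebra.TensorProduct.map p (AlgHom.id k B) t) :=
  actTensor_comp α β p (AlgHom.id k B) t

theorem actTensor_comp_right (q : B' →ₐ[k] B) (t : A ⊗[k] B') :
    actTensor α (β.comp q) t =
      actTensor α β (Algebra.TensorProduct.map (AlgHom.id k A) q t) :=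
  actTensor_comp α β (AlgHom.id k A) q t

theorem actTensor_one_tmul (b : B) :
    actTensor α β (1 ⊗ₜ b) = TensorProduct.map LinearMap.id (β b) := by
  ext; simp

theorem actTensor_tmul_one (a : A) :
    actTensor α β (a ⊗ₜ 1) = TensorProduct.map (α a) LinearMap.id := by
  ext; simp

theorem map_id_comp_apply (f : N →ₗ[k] P) (g : Q →ₗ[k] N) (m : M ⊗[k] Q) :
    TensorProduct.map LinearMap.id (f ∘ₗ g) m =
      TensorProduct.map (LinearMap.id : M →ₗ[k] M) f (TensorProduct.map LinearMap.id g m) := by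
  rw [← LinearMap.comp_apply, ← TensorProduct.map_comp, LinearMap.id_comp]

theorem actTensor_mul_apply (s t : A ⊗[k] B) (m : M ⊗[k] N) :
    actTensor α β (s * t) m = actTensor α β s (actTensor α β t m) := by
  rw [map_mul]; rfl

theorem actTensor_assoc (t : (A ⊗[k] B) ⊗[k] C) (m : (M ⊗[k] N) ⊗[k] P) :
    TensorProduct.assoc k M N P (actTensor (actTensor α β) γ t m) =
      actTensor α (actTensor β γ) (Algebra.TensorProduct.assoc k k k A B C t)
        (TensorProduct.assoc k M N P m) := by
  induction t with
  | zero => simp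
  | add s t hs ht => simp [hs, ht]
  | tmul t c =>
    induction t with
    | zero => simp
    | add s t hs ht => simp only [map_add, TensorProduct.add_tmul, LinearMap.add_apply, hs, ht]
    | tmul a b =>
      induction m with
      | zero => simp
      | add m n hm hn => simp only [map_add, hm, hn]
      | tmul m p =>
        induction m with
        | zero => simp
        | add m n hm hn => simp only [map_add, TensorProduct.add_tmul, hm, hn]
        | tmul m n => simp

theorem actTensor_assoc_symm (t : A ⊗[k] (B ⊗[k] C)) (m : M ⊗[k] (N ⊗[k] P)) :
    (TensorProduct.assoc k M N P).symm (actTensor α (actTensor β γ) t m) =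
      actTensor (actTensor α β) γ ((Algebra.TensorProduct.assoc k k k A B C).symm t)
        ((TensorProduct.assoc k M N P).symm m) := by
  rw [LinearEquiv.symm_apply_eq, actTensor_assoc]
  simp

theorem actTensor_comm (t : A ⊗[k] B) (m : M ⊗[k] N) :
    TensorProduct.comm k M N (actTensor α β t m) =
      actTensor β α (Algebra.TensorProduct.comm k A B t) (TensorProduct.comm k M N m) := by
  induction t with
  | zero => simp
  | add s t hs ht => simp [hs, ht]
  | tmul a b =>
    induction m with
    | zero => simp
    | add m n hm hn => simp only [map_add, hm, hn]
    | tmul m n => simp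

theorem actTensor_lid (ε : A →ₐ[k] k) (t : A ⊗[k] B) (m : k ⊗[k] N) :
    TensorProduct.lid k N (actTensor ((Algebra.ofId k (Module.End k k)).comp ε) β t m) =
      β (Algebra.TensorProduct.lid k B (Algebra.TensorProduct.map ε (AlgHom.id k B) t))
        (TensorProduct.lid k N m) := by
  induction t with
  | zero => simp
  | add s t hs ht => simp [hs, ht]
  | tmul a b =>
    induction m with
    | zero => simp
    | add m n hm hn => simp only [map_add, hm, hn]
    | tmul m n => simp [Algebra.ofId_apply, mul_smul, smul_comm m]

theorem actTensor_rid (ε : B →ₐ[k] k) (t : A ⊗[k] B) (m : M ⊗[k] k) :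
    TensorProduct.rid k M (actTensor α ((Algebra.ofId k (Module.End k k)).comp ε) t m) =
      α (Algebra.TensorProduct.rid k k A (Algebra.TensorProduct.map (AlgHom.id k A) ε t))
        (TensorProduct.rid k M m) := by
  induction t with
  | zero => simp
  | add s t hs ht => simp [hs, ht]
  | tmul a b =>
    induction m with
    | zero => simp
    | add m n hm hn => simp only [map_add, hm, hn]
    | tmul m n => simp [Algebra.ofId_apply, mul_smul, smul_comm n]

end

end TensorActions

/-- A left module over a `k`-algebra `H`: a vector space with an action of `H`. -/
structure LeftMod (k : Type u) [Field k] (H : Type w) [Ring H] [Algebra k H] where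
  obj : ModuleCat.{u} k
  act : H →ₐ[k] Module.End k obj

namespace LeftMod

variable {k : Type u} [Field k] {H : Type w} [Ring H] [Algebra k H]

/-- A morphism of left `H`-modules: an `H`-linear map. -/
@[ext]
structure Hom (X Y : LeftMod k H) where
  hom : X.obj ⟶ Y.obj
  comm : ∀ (h : H) (x : X.obj), hom (X.act h x) = Y.act h (hom x)

instance : Category (LeftMod k H) where
  Hom := Hom
  id X := ⟨𝟙 _, fun _ _ => rfl⟩
  comp f g := ⟨f.hom ≫ g.hom, fun h x => by
    rw [ConcreteCategory.comp_apply, f.comm, g.comm, ConcreteCategory.comp_apply]⟩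
  id_comp f := Hom.ext (Category.id_comp f.hom)
  comp_id f := Hom.ext (Category.comp_id f.hom)
  assoc f g h := Hom.ext (Category.assoc f.hom g.hom h.hom)

@[ext]
theorem hom_ext {X Y : LeftMod k H} {f g : X ⟶ Y} (h : f.hom = g.hom) : f = g := Hom.ext h

@[simp] theorem id_hom (X : LeftMod k H) : Hom.hom (𝟙 X) = 𝟙 X.obj := rfl

@[simp] theorem comp_hom {X Y Z : LeftMod k H} (f : X ⟶ Y) (g : Y ⟶ Z) :
    (f ≫ g).hom = f.hom ≫ g.hom := rfl

/-- An `H`-linear bijection is an isomorphism of left `H`-modules. -/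
@[simps]
noncomputable def mkIso {X Y : LeftMod k H} (e : X.obj ≃ₗ[k] Y.obj)
    (comm : ∀ (h : H) (x : X.obj), e (X.act h x) = Y.act h (e x)) : X ≅ Y where
  hom := ⟨ModuleCat.ofHom e.toLinearMap, comm⟩
  inv := ⟨ModuleCat.ofHom e.symm.toLinearMap, fun h y => by
    change e.symm (Y.act h y) = X.act h (e.symm y)
    rw [LinearEquiv.symm_apply_eq, comm, LinearEquiv.apply_symm_apply]⟩
  hom_inv_id := by ext x; exact e.symm_apply_apply x
  inv_hom_id := by ext x; exact e.apply_symm_apply x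

end LeftMod

/-- A quasi-bialgebra structure on the `k`-algebra `H`, with reassociator `φ` and unit constraints
`l`, `r`. Iterated tensor powers of `H` are bracketed to the right. -/
structure QuasiBialgebra (k : Type u) [Field k] (H : Type w) [Ring H] [Algebra k H] where
  Δ : H →ₐ[k] H ⊗[k] H
  ε : H →ₐ[k] k
  φ : (H ⊗[k] (H ⊗[k] H))ˣ
  l : Hˣ
  r : Hˣ
  /-- `(H ⊗ H ⊗ Δ)(φ) (Δ ⊗ H ⊗ H)(φ) = (1 ⊗ φ) (H ⊗ Δ ⊗ H)(φ) (φ ⊗ 1)` -/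
  cocycle :
    Algebra.TensorProduct.map (AlgHom.id k H)
        (Algebra.TensorProduct.map (AlgHom.id k H) Δ) (φ : H ⊗[k] (H ⊗[k] H)) *
      Algebra.TensorProduct.assoc k k k H H (H ⊗[k] H)
        (Algebra.TensorProduct.map Δ (AlgHom.id k (H ⊗[k] H)) (φ : H ⊗[k] (H ⊗[k] H))) =
    (1 : H) ⊗ₜ[k] (φ : H ⊗[k] (H ⊗[k] H)) *
      Algebra.TensorProduct.map (AlgHom.id k H)
        ((Algebra.TensorProduct.assoc k k k H H H).toAlgHom.comp
          (Algebra.TensorProduct.map Δ (AlgHom.id k H))) (φ : H ⊗[k] (H ⊗[k] H)) *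
      Algebra.TensorProduct.map (AlgHom.id k H)
        (Algebra.TensorProduct.assoc k k k H H H).toAlgHom
        (Algebra.TensorProduct.assoc k k k H (H ⊗[k] H) H
          ((φ : H ⊗[k] (H ⊗[k] H)) ⊗ₜ[k] (1 : H)))
  /-- `(H ⊗ ε ⊗ H)(φ) = r ⊗ l⁻¹` -/
  counital :
    Algebra.TensorProduct.map (AlgHom.id k H)
      ((Algebra.TensorProduct.lid k H).toAlgHom.comp
        (Algebra.TensorProduct.map ε (AlgHom.id k H))) (φ : H ⊗[k] (H ⊗[k] H)) =
      (r : H) ⊗ₜ[k] (↑l⁻¹ : H)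
  /-- `(H ⊗ Δ) Δ(h) = φ (Δ ⊗ H) Δ(h) φ⁻¹` -/
  quasi_coassoc : ∀ h : H,
    Algebra.TensorProduct.map (AlgHom.id k H) Δ (Δ h) =
      (φ : H ⊗[k] (H ⊗[k] H)) * Algebra.TensorProduct.assoc k k k H H H
        (Algebra.TensorProduct.map Δ (AlgHom.id k H) (Δ h)) *
        (↑φ⁻¹ : H ⊗[k] (H ⊗[k] H))
  /-- `(ε ⊗ H) Δ(h) = l⁻¹ h l` -/
  counit_left : ∀ h : H,
    Algebra.TensorProduct.lid k H (Algebra.TensorProduct.map ε (AlgHom.id k H) (Δ h)) =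
      (↑l⁻¹ : H) * h * (l : H)
  /-- `(H ⊗ ε) Δ(h) = r⁻¹ h r` -/
  counit_right : ∀ h : H,
    Algebra.TensorProduct.rid k k H (Algebra.TensorProduct.map (AlgHom.id k H) ε (Δ h)) =
      (↑r⁻¹ : H) * h * (r : H)

namespace QuasiBialgebra

variable {k : Type u} [Field k] {H : Type w} [Ring H] [Algebra k H] (Q : QuasiBialgebra k H)

/-- The tensor product of left modules, with the diagonal action `h (x ⊗ y) = h₁ x ⊗ h₂ y`. -/
noncomputable abbrev tensorObj (X Y : LeftMod k H) : LeftMod k H :=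
  ⟨X.obj ⊗ Y.obj, (actTensor X.act Y.act).comp Q.Δ⟩

/-- The base field as a left module, with the action `h κ = ε(h) κ`. -/
noncomputable abbrev unitObj : LeftMod k H :=
  ⟨𝟙_ (ModuleCat.{u} k), (Algebra.ofId k (Module.End k k)).comp Q.ε⟩

/-- The tensor product of linear maps, as a morphism of left modules. -/
noncomputable abbrev tensorHom {X X' Y Y' : LeftMod k H} (f : X ⟶ X') (g : Y ⟶ Y') :
    Q.tensorObj X Y ⟶ Q.tensorObj X' Y' :=
  ⟨f.hom ⊗ₘ g.hom, fun h x => by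
    have := actTensor_map X.act Y.act X'.act Y'.act f.hom.hom g.hom.hom (AlgHom.id k H)
      (AlgHom.id k H) f.comm g.comm (Q.Δ h) x
    rwa [Algebra.TensorProduct.map_id] at this⟩

/-- `(x ⊗ y) ⊗ z ↦ φ¹ x ⊗ (φ² y ⊗ φ³ z)` -/
noncomputable def associator (X Y Z : LeftMod k H) :
    Q.tensorObj (Q.tensorObj X Y) Z ≅ Q.tensorObj X (Q.tensorObj Y Z) :=
  LeftMod.mkIso (TensorProduct.assoc k X.obj Y.obj Z.obj ≪≫ₗ
    actUnit (actTensor X.act (actTensor Y.act Z.act)) Q.φ) (fun h x => by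
      change actTensor X.act (actTensor Y.act Z.act) Q.φ (TensorProduct.assoc k X.obj Y.obj Z.obj
        (actTensor ((actTensor X.act Y.act).comp Q.Δ) Z.act (Q.Δ h) x)) =
        actTensor X.act ((actTensor Y.act Z.act).comp Q.Δ) (Q.Δ h)
        (actTensor X.act (actTensor Y.act Z.act) Q.φ (TensorProduct.assoc k X.obj Y.obj Z.obj x))
      rw [actTensor_comp_left, actTensor_comp_right, actTensor_assoc, ← actTensor_mul_apply,
        ← actTensor_mul_apply, Q.quasi_coassoc, mul_assoc _ _ (Q.φ : H ⊗[k] (H ⊗[k] H)),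
        Units.inv_mul, mul_one])

/-- `κ ⊗ x ↦ κ l x` -/
noncomputable def leftUnitor (X : LeftMod k H) : Q.tensorObj Q.unitObj X ≅ X :=
  LeftMod.mkIso (TensorProduct.lid k X.obj ≪≫ₗ actUnit X.act Q.l) (fun h x => by
    change X.act Q.l (TensorProduct.lid k X.obj (actTensor _ X.act (Q.Δ h) x)) =
      X.act h (X.act Q.l (TensorProduct.lid k X.obj x))
    rw [actTensor_lid, Q.counit_left, ← Module.End.mul_apply, ← Module.End.mul_apply, ← map_mul,
      ← map_mul, mul_assoc, Units.mul_inv_cancel_left])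

/-- `x ⊗ κ ↦ κ r x` -/
noncomputable def rightUnitor (X : LeftMod k H) : Q.tensorObj X Q.unitObj ≅ X :=
  LeftMod.mkIso (TensorProduct.rid k X.obj ≪≫ₗ actUnit X.act Q.r) (fun h x => by
    change X.act Q.r (TensorProduct.rid k X.obj (actTensor X.act _ (Q.Δ h) x)) =
      X.act h (X.act Q.r (TensorProduct.rid k X.obj x))
    rw [actTensor_rid, Q.counit_right, ← Module.End.mul_apply, ← Module.End.mul_apply, ← map_mul,
      ← map_mul, mul_assoc, Units.mul_inv_cancel_left])

theorem associator_naturality {X X' Y Y' Z Z' : LeftMod k H} (f : X ⟶ X') (g : Y ⟶ Y')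
    (h : Z ⟶ Z') :
    Q.tensorHom (Q.tensorHom f g) h ≫ (Q.associator X' Y' Z').hom =
      (Q.associator X Y Z).hom ≫ Q.tensorHom f (Q.tensorHom g h) := by
  apply LeftMod.hom_ext
  apply ModuleCat.MonoidalCategory.tensor_ext₃'
  intro x y z
  have h2 := fun t m => actTensor_map Y.act Z.act Y'.act Z'.act g.hom.hom h.hom.hom (AlgHom.id k H)
    (AlgHom.id k H) g.comm h.comm t m
  have h3 := actTensor_map X.act (actTensor Y.act Z.act) X'.act (actTensor Y'.act Z'.act)
    f.hom.hom (TensorProduct.map g.hom.hom h.hom.hom) (AlgHom.id k H) _ f.comm h2 Q.φ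
    (x ⊗ₜ (y ⊗ₜ z))
  rw [Algebra.TensorProduct.map_id, Algebra.TensorProduct.map_id] at h3
  exact h3.symm

theorem leftUnitor_naturality {X X' : LeftMod k H} (f : X ⟶ X') :
    Q.tensorHom (𝟙 _) f ≫ (Q.leftUnitor X').hom = (Q.leftUnitor X).hom ≫ f := by
  apply LeftMod.hom_ext
  apply ModuleCat.MonoidalCategory.tensor_ext
  intro c x
  change X'.act Q.l ((c : k) • f.hom.hom x) = f.hom.hom (X.act Q.l ((c : k) • x))
  rw [← map_smul]
  exact (f.comm _ _).symm

theorem rightUnitor_naturality {X X' : LeftMod k H} (f : X ⟶ X') :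
    Q.tensorHom f (𝟙 _) ≫ (Q.rightUnitor X').hom = (Q.rightUnitor X).hom ≫ f := by
  apply LeftMod.hom_ext
  apply ModuleCat.MonoidalCategory.tensor_ext
  intro x c
  change X'.act Q.r ((c : k) • f.hom.hom x) = f.hom.hom (X.act Q.r ((c : k) • x))
  rw [← map_smul]
  exact (f.comm _ _).symm

theorem pentagon (U V W X : LeftMod k H) :
    Q.tensorHom (Q.associator U V W).hom (𝟙 X) ≫ (Q.associator U (Q.tensorObj V W) X).hom ≫
        Q.tensorHom (𝟙 U) (Q.associator V W X).hom =
      (Q.associator (Q.tensorObj U V) W X).hom ≫ (Q.associator U V (Q.tensorObj W X)).hom := by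
  apply LeftMod.hom_ext
  apply ModuleCat.hom_ext
  apply TensorProduct.ext_fourfold
  intro u v w x
  change TensorProduct.map LinearMap.id (actTensor V.act (actTensor W.act X.act) Q.φ ∘ₗ
      (TensorProduct.assoc k V.obj W.obj X.obj).toLinearMap)
        (actTensor U.act (actTensor ((actTensor V.act W.act).comp Q.Δ) X.act) Q.φ
          (TensorProduct.assoc k U.obj (V.obj ⊗[k] W.obj) X.obj
            (TensorProduct.map (actTensor U.act (actTensor V.act W.act) Q.φ) LinearMap.id
              ((u ⊗ₜ[k] (v ⊗ₜ[k] w)) ⊗ₜ[k] x)))) =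
    actTensor U.act (actTensor V.act ((actTensor W.act X.act).comp Q.Δ)) Q.φ
      (TensorProduct.assoc k U.obj V.obj (W.obj ⊗[k] X.obj)
        (actTensor ((actTensor U.act V.act).comp Q.Δ) (actTensor W.act X.act) Q.φ
          ((u ⊗ₜ[k] v) ⊗ₜ[k] (w ⊗ₜ[k] x))))
  have e1 : actTensor ((actTensor V.act W.act).comp Q.Δ) X.act =
      (actTensor (actTensor V.act W.act) X.act).comp
        (Algebra.TensorProduct.map Q.Δ (AlgHom.id k H)) :=
    AlgHom.ext fun t => actTensor_comp_left _ _ _ t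
  have e2 : actTensor V.act ((actTensor W.act X.act).comp Q.Δ) =
      (actTensor V.act (actTensor W.act X.act)).comp
        (Algebra.TensorProduct.map (AlgHom.id k H) Q.Δ) :=
    AlgHom.ext fun t => actTensor_comp_right _ _ _ t
  have e3 : ∀ t : H ⊗[k] (H ⊗[k] H), Algebra.TensorProduct.map (AlgHom.id k H)
      ((Algebra.TensorProduct.assoc k k k H H H).toAlgHom.comp
        (Algebra.TensorProduct.map Q.Δ (AlgHom.id k H))) t =
      Algebra.TensorProduct.map (AlgHom.id k H)
        (Algebra.TensorProduct.assoc k k k H H H).toAlgHom (Algebra.TensorProduct.map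
          (AlgHom.id k H) (Algebra.TensorProduct.map Q.Δ (AlgHom.id k H)) t) := fun t => by
    rw [← AlgHom.comp_apply, ← Algebra.TensorProduct.map_comp, AlgHom.id_comp]
  rw [map_id_comp_apply, e1, e2, actTensor_comp_right, actTensor_comp_right, actTensor_comp_left,
    actTensor_assoc, ← actTensor_tmul_one _ X.act, actTensor_assoc, ← actTensor_mul_apply,
    ← actTensor_mul_apply,
    actTensor_map U.act (actTensor (actTensor V.act W.act) X.act) U.act
      (actTensor V.act (actTensor W.act X.act)) LinearMap.id
      (TensorProduct.assoc k V.obj W.obj X.obj).toLinearMap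
      (AlgHom.id k H) (Algebra.TensorProduct.assoc k k k H H H).toAlgHom (fun _ _ => rfl)
      (fun t m => actTensor_assoc V.act W.act X.act t m),
    ← actTensor_one_tmul U.act (actTensor V.act (actTensor W.act X.act)),
    ← actTensor_mul_apply, Q.cocycle, e3]
  simp only [map_mul, mul_assoc]
  rfl

theorem triangle (V W : LeftMod k H) :
    (Q.associator V Q.unitObj W).hom ≫ Q.tensorHom (𝟙 V) (Q.leftUnitor W).hom =
      Q.tensorHom (Q.rightUnitor V).hom (𝟙 W) := by
  apply LeftMod.hom_ext
  apply ModuleCat.MonoidalCategory.tensor_ext₃'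
  intro v c w
  change TensorProduct.map LinearMap.id (W.act Q.l ∘ₗ (TensorProduct.lid k W.obj).toLinearMap)
        (actTensor V.act (actTensor ((Algebra.ofId k (Module.End k k)).comp Q.ε) W.act) Q.φ
          (v ⊗ₜ[k] (c ⊗ₜ[k] w))) = V.act Q.r ((c : k) • v) ⊗ₜ[k] w
  rw [map_id_comp_apply, actTensor_map V.act _ V.act W.act LinearMap.id _ (AlgHom.id k H)
    ((Algebra.TensorProduct.lid k H).toAlgHom.comp
        (Algebra.TensorProduct.map Q.ε (AlgHom.id k H))) (fun _ _ => rfl)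
    (fun t m => actTensor_lid W.act Q.ε t m), Q.counital, ← actTensor_one_tmul V.act W.act,
    ← actTensor_mul_apply, Algebra.TensorProduct.tmul_mul_tmul, one_mul, Units.mul_inv,
    actTensor_tmul_one]
  change V.act Q.r v ⊗ₜ[k] ((c : k) • w) = _
  rw [map_smul, TensorProduct.smul_tmul]

/-- The monoidal category of left modules over a quasi-bialgebra. -/
@[reducible]
noncomputable def monoidalCategory : MonoidalCategory (LeftMod k H) :=
  letI : MonoidalCategoryStruct (LeftMod k H) :=
    { tensorObj := Q.tensorObj
      tensorUnit := Q.unitObj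
      tensorHom := Q.tensorHom
      whiskerLeft := fun X _ _ g => Q.tensorHom (𝟙 X) g
      whiskerRight := fun f Y => Q.tensorHom f (𝟙 Y)
      associator := Q.associator
      leftUnitor := Q.leftUnitor
      rightUnitor := Q.rightUnitor }
  MonoidalCategory.ofTensorHom
    (id_tensorHom_id := fun X Y => by
      ext : 1; exact MonoidalCategory.id_tensorHom_id X.obj Y.obj)
    (id_tensorHom := fun _ _ _ _ => rfl)
    (tensorHom_id := fun _ _ => rfl)
    (tensorHom_comp_tensorHom := fun f g h i => by
      ext : 1; exact MonoidalCategory.tensorHom_comp_tensorHom f.hom g.hom h.hom i.hom)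
    (associator_naturality := Q.associator_naturality)
    (leftUnitor_naturality := Q.leftUnitor_naturality)
    (rightUnitor_naturality := Q.rightUnitor_naturality)
    (pentagon := Q.pentagon)
    (triangle := Q.triangle)

end QuasiBialgebra

/-- The algebra automorphism `x ⊗ (y ⊗ z) ↦ y ⊗ (z ⊗ x)`. -/
noncomputable def rotate (k : Type u) [Field k] (H : Type w) [Ring H] [Algebra k H] :
    H ⊗[k] (H ⊗[k] H) ≃ₐ[k] H ⊗[k] (H ⊗[k] H) :=
  (Algebra.TensorProduct.comm k H (H ⊗[k] H)).trans (Algebra.TensorProduct.assoc k k k H H H)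

/-- A quasi-triangular structure on the quasi-bialgebra `Q`: a universal `R`-matrix. -/
structure QuasiTriangular {k : Type u} [Field k] {H : Type w} [Ring H] [Algebra k H]
    (Q : QuasiBialgebra k H) where
  R : (H ⊗[k] H)ˣ
  /-- `(Δ ⊗ H)(R) = (φ² ⊗ φ³ ⊗ φ¹) (R¹ ⊗ 1 ⊗ R²) (φ¹ ⊗ φ³ ⊗ φ²)⁻¹ (1 ⊗ R¹ ⊗ R²) φ` -/
  hexagon₁ :
    Algebra.TensorProduct.assoc k k k H H H
        (Algebra.TensorProduct.map Q.Δ (AlgHom.id k H) (R : H ⊗[k] H)) =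
      rotate k H (Q.φ : H ⊗[k] (H ⊗[k] H)) *
        Algebra.TensorProduct.map (AlgHom.id k H) Algebra.TensorProduct.includeRight
          (R : H ⊗[k] H) *
        Algebra.TensorProduct.map (AlgHom.id k H) (Algebra.TensorProduct.comm k H H).toAlgHom
          (↑Q.φ⁻¹ : H ⊗[k] (H ⊗[k] H)) *
        (1 : H) ⊗ₜ[k] (R : H ⊗[k] H) * (Q.φ : H ⊗[k] (H ⊗[k] H))
  /-- `(H ⊗ Δ)(R) = (φ³ ⊗ φ¹ ⊗ φ²)⁻¹ (R¹ ⊗ 1 ⊗ R²) (φ² ⊗ φ¹ ⊗ φ³) (R¹ ⊗ R² ⊗ 1) φ⁻¹` -/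
  hexagon₂ :
    Algebra.TensorProduct.map (AlgHom.id k H) Q.Δ (R : H ⊗[k] H) =
      (rotate k H).symm (↑Q.φ⁻¹ : H ⊗[k] (H ⊗[k] H)) *
        Algebra.TensorProduct.map (AlgHom.id k H) Algebra.TensorProduct.includeRight
          (R : H ⊗[k] H) *
        Algebra.TensorProduct.leftComm k H H H (Q.φ : H ⊗[k] (H ⊗[k] H)) *
        Algebra.TensorProduct.map (AlgHom.id k H) Algebra.TensorProduct.includeLeft
          (R : H ⊗[k] H) *
        (↑Q.φ⁻¹ : H ⊗[k] (H ⊗[k] H))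
  /-- `Δᶜᵒᵖ(h) = R Δ(h) R⁻¹` -/
  almost_cocomm : ∀ h : H,
    Algebra.TensorProduct.comm k H H (Q.Δ h) =
      (R : H ⊗[k] H) * Q.Δ h * (↑R⁻¹ : H ⊗[k] H)

namespace QuasiTriangular

variable {k : Type u} [Field k] {H : Type w} [Ring H] [Algebra k H] {Q : QuasiBialgebra k H}
  (T : QuasiTriangular Q)

/-- `x ⊗ y ↦ R² y ⊗ R¹ x` -/
noncomputable def braiding (X Y : LeftMod k H) : Q.tensorObj X Y ≅ Q.tensorObj Y X :=
  LeftMod.mkIso (actUnit (actTensor X.act Y.act) T.R ≪≫ₗ TensorProduct.comm k X.obj Y.obj)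
    (fun h x => by
      change TensorProduct.comm k X.obj Y.obj (actTensor X.act Y.act T.R
        (actTensor X.act Y.act (Q.Δ h) x)) = actTensor Y.act X.act (Q.Δ h)
          (TensorProduct.comm k X.obj Y.obj (actTensor X.act Y.act T.R x))
      have h1 := actTensor_comm X.act Y.act (Algebra.TensorProduct.comm k H H (Q.Δ h))
        (actTensor X.act Y.act T.R x)
      rw [T.almost_cocomm, ← actTensor_mul_apply, Units.inv_mul_cancel_right,
        ← T.almost_cocomm] at h1
      rw [← actTensor_mul_apply, h1]
      congr 2
      exact (Algebra.TensorProduct.comm k H H).symm_apply_apply (Q.Δ h))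

theorem braiding_naturality {X X' Y Y' : LeftMod k H} (f : X ⟶ X') (g : Y ⟶ Y') :
    Q.tensorHom f g ≫ (T.braiding X' Y').hom = (T.braiding X Y).hom ≫ Q.tensorHom g f := by
  apply LeftMod.hom_ext
  apply ModuleCat.MonoidalCategory.tensor_ext
  intro x y
  have h := actTensor_map X.act Y.act X'.act Y'.act f.hom.hom g.hom.hom (AlgHom.id k H)
    (AlgHom.id k H) f.comm g.comm T.R (x ⊗ₜ y)
  rw [Algebra.TensorProduct.map_id] at h
  change TensorProduct.comm k X'.obj Y'.obj (actTensor X'.act Y'.act T.R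
      (TensorProduct.map f.hom.hom g.hom.hom (x ⊗ₜ y))) =
    TensorProduct.map g.hom.hom f.hom.hom (TensorProduct.comm k X.obj Y.obj
      (actTensor X.act Y.act T.R (x ⊗ₜ y)))
  rw [← AlgHom.id_apply (R := k) (T.R : H ⊗[k] H), ← h, TensorProduct.map_comm]
  rfl

theorem hexagon_forward (X Y Z : LeftMod k H) :
    (Q.associator X Y Z).hom ≫ (T.braiding X (Q.tensorObj Y Z)).hom ≫ (Q.associator Y Z X).hom =
      Q.tensorHom (T.braiding X Y).hom (𝟙 Z) ≫ (Q.associator Y X Z).hom ≫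
        Q.tensorHom (𝟙 Y) (T.braiding X Z).hom := by
  apply LeftMod.hom_ext
  apply ModuleCat.MonoidalCategory.tensor_ext₃'
  intro x y z
  change actTensor Y.act (actTensor Z.act X.act) Q.φ (TensorProduct.assoc k Y.obj Z.obj X.obj
      (TensorProduct.comm k X.obj (Y.obj ⊗[k] Z.obj)
        (actTensor X.act ((actTensor Y.act Z.act).comp Q.Δ) T.R
          (actTensor X.act (actTensor Y.act Z.act) Q.φ (x ⊗ₜ (y ⊗ₜ z)))))) =
    TensorProduct.map LinearMap.id
      ((TensorProduct.comm k X.obj Z.obj).toLinearMap ∘ₗ actTensor X.act Z.act T.R)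
      (actTensor Y.act (actTensor X.act Z.act) Q.φ (TensorProduct.assoc k Y.obj X.obj Z.obj
        (TensorProduct.map (TensorProduct.comm k X.obj Y.obj).toLinearMap LinearMap.id
          (TensorProduct.map (actTensor X.act Y.act T.R) LinearMap.id ((x ⊗ₜ y) ⊗ₜ z)))))
  have key : (Q.φ : H ⊗[k] (H ⊗[k] H)) * rotate k H
        (Algebra.TensorProduct.map (AlgHom.id k H) Q.Δ (T.R : H ⊗[k] H) * Q.φ) =
      Algebra.TensorProduct.map (AlgHom.id k H) (Algebra.TensorProduct.comm k H H).toAlgHom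
        ((1 : H) ⊗ₜ[k] (T.R : H ⊗[k] H) * (Q.φ * Algebra.TensorProduct.assoc k k k H H H
          (Algebra.TensorProduct.map (Algebra.TensorProduct.comm k H H).toAlgHom (AlgHom.id k H)
            ((T.R : H ⊗[k] H) ⊗ₜ[k] (1 : H))))) := by
    have e1 : ∀ t : H ⊗[k] H, rotate k H (Algebra.TensorProduct.map (AlgHom.id k H)
        Algebra.TensorProduct.includeRight t) = Algebra.TensorProduct.map (AlgHom.id k H)
          (Algebra.TensorProduct.comm k H H).toAlgHom ((1 : H) ⊗ₜ[k] t) := fun t => by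
      induction t with
      | zero => simp
      | add s t hs ht => simp only [map_add, TensorProduct.tmul_add, hs, ht]
      | tmul a b => simp [rotate]
    have e2 : ∀ t : H ⊗[k] H, rotate k H (Algebra.TensorProduct.map (AlgHom.id k H)
        Algebra.TensorProduct.includeLeft t) = Algebra.TensorProduct.map (AlgHom.id k H)
          (Algebra.TensorProduct.comm k H H).toAlgHom (Algebra.TensorProduct.assoc k k k H H H
          (Algebra.TensorProduct.map (Algebra.TensorProduct.comm k H H).toAlgHom (AlgHom.id k H)
            (t ⊗ₜ[k] (1 : H)))) := fun t => by
      induction t with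
      | zero => simp
      | add s t hs ht => simp only [map_add, TensorProduct.add_tmul, hs, ht]
      | tmul a b => simp [rotate]
    have e3 : ∀ t : H ⊗[k] (H ⊗[k] H), rotate k H (Algebra.TensorProduct.leftComm k H H H t) =
        Algebra.TensorProduct.map (AlgHom.id k H)
          (Algebra.TensorProduct.comm k H H).toAlgHom t := fun t => by
      induction t with
      | zero => simp
      | add s t hs ht => simp only [map_add, hs, ht]
      | tmul a t =>
        induction t with
        | zero => simp
        | add s t hs ht => simp only [map_add, TensorProduct.tmul_add, hs, ht]
        | tmul b c => simp [rotate]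
    rw [T.hexagon₂, Units.inv_mul_cancel_right, map_mul, map_mul, map_mul,
      AlgEquiv.apply_symm_apply, e1, e2, e3]
    simp only [map_mul, mul_assoc, Units.mul_inv_cancel_left]
  rw [actTensor_comp_right, ← actTensor_mul_apply, actTensor_comm, actTensor_assoc,
    ← actTensor_mul_apply, map_id_comp_apply, ← actTensor_tmul_one _ Z.act,
    actTensor_map (actTensor X.act Y.act) Z.act (actTensor Y.act X.act) Z.act
      (TensorProduct.comm k X.obj Y.obj).toLinearMap LinearMap.id
      (Algebra.TensorProduct.comm k H H).toAlgHom (AlgHom.id k H)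
      (fun t m => actTensor_comm X.act Y.act t m) (fun _ _ => rfl), actTensor_assoc,
    ← actTensor_mul_apply, ← actTensor_one_tmul Y.act, ← actTensor_mul_apply,
    actTensor_map Y.act (actTensor X.act Z.act) Y.act (actTensor Z.act X.act)
      LinearMap.id (TensorProduct.comm k X.obj Z.obj).toLinearMap
      (AlgHom.id k H) (Algebra.TensorProduct.comm k H H).toAlgHom (fun _ _ => rfl)
      (fun t m => actTensor_comm X.act Z.act t m)]
  exact congrArg (fun t => actTensor Y.act (actTensor Z.act X.act) t (y ⊗ₜ (z ⊗ₜ x))) key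

theorem hexagon_reverse (X Y Z : LeftMod k H) :
    (Q.associator X Y Z).inv ≫ (T.braiding (Q.tensorObj X Y) Z).hom ≫ (Q.associator Z X Y).inv =
      Q.tensorHom (𝟙 X) (T.braiding Y Z).hom ≫ (Q.associator X Z Y).inv ≫
        Q.tensorHom (T.braiding X Z).hom (𝟙 Y) := by
  apply LeftMod.hom_ext
  apply ModuleCat.MonoidalCategory.tensor_ext₃
  intro x y z
  change (TensorProduct.assoc k Z.obj X.obj Y.obj).symm
      (actTensor Z.act (actTensor X.act Y.act) (↑Q.φ⁻¹ : H ⊗[k] (H ⊗[k] H))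
        (TensorProduct.comm k (X.obj ⊗[k] Y.obj) Z.obj
          (actTensor ((actTensor X.act Y.act).comp Q.Δ) Z.act T.R
            ((TensorProduct.assoc k X.obj Y.obj Z.obj).symm
              (actTensor X.act (actTensor Y.act Z.act) (↑Q.φ⁻¹ : H ⊗[k] (H ⊗[k] H))
                (x ⊗ₜ (y ⊗ₜ z))))))) =
    TensorProduct.map ((TensorProduct.comm k X.obj Z.obj).toLinearMap ∘ₗ
      actTensor X.act Z.act T.R) LinearMap.id
      ((TensorProduct.assoc k X.obj Z.obj Y.obj).symm
        (actTensor X.act (actTensor Z.act Y.act) (↑Q.φ⁻¹ : H ⊗[k] (H ⊗[k] H))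
          (TensorProduct.map LinearMap.id (TensorProduct.comm k Y.obj Z.obj).toLinearMap
            (TensorProduct.map LinearMap.id (actTensor Y.act Z.act T.R) (x ⊗ₜ (y ⊗ₜ z))))))
  have key : (Algebra.TensorProduct.assoc k k k H H H).symm ((↑Q.φ⁻¹ : H ⊗[k] (H ⊗[k] H)) *
        Algebra.TensorProduct.comm k (H ⊗[k] H) H
          (Algebra.TensorProduct.map Q.Δ (AlgHom.id k H) (T.R : H ⊗[k] H) *
            (Algebra.TensorProduct.assoc k k k H H H).symm (↑Q.φ⁻¹ : H ⊗[k] (H ⊗[k] H)))) =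
      Algebra.TensorProduct.map (Algebra.TensorProduct.comm k H H).toAlgHom (AlgHom.id k H)
        ((T.R : H ⊗[k] H) ⊗ₜ[k] (1 : H) * (Algebra.TensorProduct.assoc k k k H H H).symm
          ((↑Q.φ⁻¹ : H ⊗[k] (H ⊗[k] H)) * Algebra.TensorProduct.map (AlgHom.id k H)
            (Algebra.TensorProduct.comm k H H).toAlgHom ((1 : H) ⊗ₜ[k] (T.R : H ⊗[k] H)))) := by
    have e1 : ∀ t : H ⊗[k] H, (Algebra.TensorProduct.assoc k k k H H H).symm ((rotate k H).symm
        (Algebra.TensorProduct.map (AlgHom.id k H) Algebra.TensorProduct.includeRight t)) =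
        Algebra.TensorProduct.map (Algebra.TensorProduct.comm k H H).toAlgHom (AlgHom.id k H)
          (t ⊗ₜ[k] (1 : H)) := fun t => by
      induction t with
      | zero => simp
      | add s t hs ht => simp only [map_add, TensorProduct.add_tmul, hs, ht]
      | tmul a b => simp [rotate]
    have e2 : ∀ t : H ⊗[k] (H ⊗[k] H),
        (Algebra.TensorProduct.assoc k k k H H H).symm ((rotate k H).symm
        (Algebra.TensorProduct.map (AlgHom.id k H)
          (Algebra.TensorProduct.comm k H H).toAlgHom t)) =
        Algebra.TensorProduct.map (Algebra.TensorProduct.comm k H H).toAlgHom (AlgHom.id k H)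
          ((Algebra.TensorProduct.assoc k k k H H H).symm t) := fun t => by
      induction t with
      | zero => simp
      | add s t hs ht => simp only [map_add, hs, ht]
      | tmul a t =>
        induction t with
        | zero => simp
        | add s t hs ht => simp only [map_add, TensorProduct.tmul_add, hs, ht]
        | tmul b c => simp [rotate]
    have e3 : ∀ t : H ⊗[k] H, (Algebra.TensorProduct.assoc k k k H H H).symm ((rotate k H).symm
        ((1 : H) ⊗ₜ[k] t)) =
        Algebra.TensorProduct.map (Algebra.TensorProduct.comm k H H).toAlgHom (AlgHom.id k H)
          ((Algebra.TensorProduct.assoc k k k H H H).symm (Algebra.TensorProduct.map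
            (AlgHom.id k H) (Algebra.TensorProduct.comm k H H).toAlgHom ((1 : H) ⊗ₜ[k] t))) :=
      fun t => by
      induction t with
      | zero => simp
      | add s t hs ht => simp only [map_add, TensorProduct.tmul_add, hs, ht]
      | tmul a b => simp [rotate]
    have e4 : ∀ t, Algebra.TensorProduct.comm k (H ⊗[k] H) H
        ((Algebra.TensorProduct.assoc k k k H H H).symm t) = (rotate k H).symm t := fun _ => rfl
    have e5 : Algebra.TensorProduct.map Q.Δ (AlgHom.id k H) (T.R : H ⊗[k] H) =
        (Algebra.TensorProduct.assoc k k k H H H).symm (Algebra.TensorProduct.assoc k k k H H H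
          (Algebra.TensorProduct.map Q.Δ (AlgHom.id k H) (T.R : H ⊗[k] H))) :=
      ((Algebra.TensorProduct.assoc k k k H H H).symm_apply_apply _).symm
    rw [e5, T.hexagon₁, ← map_mul, e4, Units.mul_inv_cancel_right, mul_assoc, mul_assoc,
      map_mul (rotate k H).symm, AlgEquiv.symm_apply_apply, Units.inv_mul_cancel_left]
    simp only [map_mul, e1, e2, e3]
  rw [actTensor_comp_left, actTensor_assoc_symm X.act Y.act Z.act, ← actTensor_mul_apply,
    actTensor_comm, ← actTensor_mul_apply, actTensor_assoc_symm, ← actTensor_one_tmul X.act,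
    actTensor_map X.act (actTensor Y.act Z.act) X.act (actTensor Z.act Y.act)
      LinearMap.id (TensorProduct.comm k Y.obj Z.obj).toLinearMap
      (AlgHom.id k H) (Algebra.TensorProduct.comm k H H).toAlgHom (fun _ _ => rfl)
      (fun t m => actTensor_comm Y.act Z.act t m),
    ← actTensor_mul_apply, actTensor_assoc_symm, ← LinearMap.id_comp (LinearMap.id (M := Y.obj)),
    TensorProduct.map_comp, LinearMap.comp_apply, ← actTensor_tmul_one _ Y.act,
    ← actTensor_mul_apply,
    actTensor_map (actTensor X.act Z.act) Y.act (actTensor Z.act X.act) Y.act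
      (TensorProduct.comm k X.obj Z.obj).toLinearMap LinearMap.id
      (Algebra.TensorProduct.comm k H H).toAlgHom (AlgHom.id k H)
      (fun t m => actTensor_comm X.act Z.act t m) (fun _ _ => rfl)]
  exact congrArg (fun t => actTensor (actTensor Z.act X.act) Y.act t ((z ⊗ₜ x) ⊗ₜ y)) key

/-- The braided category of left modules over a quasi-triangular quasi-bialgebra. -/
@[reducible]
noncomputable def braidedCategory : @BraidedCategory (LeftMod k H) _ Q.monoidalCategory :=
  letI := Q.monoidalCategory
  { braiding := T.braiding
    braiding_naturality_right := fun X _ _ f => T.braiding_naturality (𝟙 X) f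
    braiding_naturality_left := fun f Z => T.braiding_naturality f (𝟙 Z)
    hexagon_forward := T.hexagon_forward
    hexagon_reverse := T.hexagon_reverse }

/-- The symmetric category of left modules over a triangular quasi-bialgebra, that is, a
quasi-triangular one with `R² ⊗ R¹ = R⁻¹`. -/
@[reducible]
noncomputable def symmetricCategory
    (h : Algebra.TensorProduct.comm k H H (T.R : H ⊗[k] H) = (↑T.R⁻¹ : H ⊗[k] H)) :
    @SymmetricCategory (LeftMod k H) _ Q.monoidalCategory :=
  letI := Q.monoidalCategory
  { toBraidedCategory := T.braidedCategory
    symmetry := fun X Y => by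
      apply LeftMod.hom_ext
      apply ModuleCat.MonoidalCategory.tensor_ext
      intro x y
      change TensorProduct.comm k Y.obj X.obj (actTensor Y.act X.act T.R
        (TensorProduct.comm k X.obj Y.obj (actTensor X.act Y.act T.R (x ⊗ₜ y)))) = x ⊗ₜ y
      rw [actTensor_comm Y.act X.act, h]
      change actTensor X.act Y.act _ ((TensorProduct.comm k X.obj Y.obj).symm
        (TensorProduct.comm k X.obj Y.obj _)) = _
      rw [LinearEquiv.symm_apply_apply, ← actTensor_mul_apply, Units.inv_mul, map_one]
      rfl }

end QuasiTriangular

section Laurent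

/-- The group algebra `k[⟨g⟩]` of the infinite cyclic group. -/
abbrev CyclicGroupAlgebra (k : Type u) [Field k] : Type u := MonoidAlgebra k (Multiplicative ℤ)

/-- The power `g ^ n` of the generator `g`, as a unit of `k[⟨g⟩]`. -/
noncomputable def genPow (k : Type u) [Field k] (n : ℤ) : (CyclicGroupAlgebra k)ˣ :=
  Units.map (MonoidAlgebra.of k (Multiplicative ℤ)) (toUnits (Multiplicative.ofAdd n))

/-- The tensor product of two units. -/
@[simps]
def tmulUnit (k : Type u) [Field k] {A B : Type*} [Ring A] [Algebra k A] [Ring B] [Algebra k B]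
    (a : Aˣ) (b : Bˣ) : (A ⊗[k] B)ˣ where
  val := (a : A) ⊗ₜ[k] (b : B)
  inv := (↑a⁻¹ : A) ⊗ₜ[k] (↑b⁻¹ : B)
  val_inv := by simp [Algebra.TensorProduct.one_def]
  inv_val := by simp [Algebra.TensorProduct.one_def]

variable (k : Type u) [Field k]

theorem genPow_add (m n : ℤ) : genPow k (m + n) = genPow k m * genPow k n := by
  simp [genPow, ofAdd_add]

theorem genPow_zero : genPow k 0 = 1 := by
  simp [genPow]

theorem genPow_neg (n : ℤ) : (genPow k n)⁻¹ = genPow k (-n) := by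
  rw [inv_eq_iff_mul_eq_one, ← genPow_add, add_neg_cancel, genPow_zero]

@[simp] theorem comul_genPow (n : ℤ) :
    CoalgebraStruct.comul (R := k) (genPow k n : CyclicGroupAlgebra k) =
      (genPow k n : CyclicGroupAlgebra k) ⊗ₜ[k] (genPow k n : CyclicGroupAlgebra k) := by
  simp [genPow]

@[simp] theorem counit_genPow (n : ℤ) :
    CoalgebraStruct.counit (R := k) (genPow k n : CyclicGroupAlgebra k) = 1 := by
  simp [genPow]

/-- The quasi-bialgebra `k[⟨g⟩]^{a,b}_q`: the usual bialgebra structure of the group algebra, with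
`φ = g^a ⊗ 1 ⊗ g^b`, `λ = q g^{-b}` and `ρ = q g^a`. -/
noncomputable def cyclicQuasiBialgebra (q : kˣ) (a b : ℤ) :
    QuasiBialgebra k (CyclicGroupAlgebra k) where
  Δ := Bialgebra.comulAlgHom k (CyclicGroupAlgebra k)
  ε := Bialgebra.counitAlgHom k (CyclicGroupAlgebra k)
  φ := tmulUnit k (genPow k a) (tmulUnit k 1 (genPow k b))
  l := Units.map (algebraMap k (CyclicGroupAlgebra k)).toMonoidHom q * genPow k (-b)
  r := Units.map (algebraMap k (CyclicGroupAlgebra k)).toMonoidHom q * genPow k a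
  cocycle := by
    simp [Algebra.TensorProduct.one_def]
  counital := by
    have e : ∀ x y : CyclicGroupAlgebra k, (algebraMap k _ (q : k) * x) ⊗ₜ[k]
        (y * algebraMap k _ (↑q⁻¹ : k)) = x ⊗ₜ[k] y := fun x y => by
      rw [mul_comm y, ← Algebra.smul_def, ← Algebra.smul_def, TensorProduct.smul_tmul_smul]
      simp
    refine Eq.trans ?_ (e (genPow k a : CyclicGroupAlgebra k) (genPow k b)).symm
      |>.trans ?_
    · simp
    · simp [genPow_neg]
  quasi_coassoc h := by
    rw [Units.eq_mul_inv_iff_mul_eq]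
    refine (mul_comm (G := CyclicGroupAlgebra k ⊗[k] (CyclicGroupAlgebra k ⊗[k]
      CyclicGroupAlgebra k)) _ _).trans ?_
    congr 1
    exact (Coalgebra.coassoc_apply h).symm
  counit_left h := by
    rw [mul_assoc, mul_comm h, Units.inv_mul_cancel_left]
    exact (congrArg (Algebra.TensorProduct.lid k (CyclicGroupAlgebra k))
      (Coalgebra.rTensor_counit_comul h)).trans (by simp)
  counit_right h := by
    rw [mul_assoc, mul_comm h, Units.inv_mul_cancel_left]
    exact (congrArg (Algebra.TensorProduct.rid k k (CyclicGroupAlgebra k))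
      (Coalgebra.lTensor_counit_comul h)).trans (by simp)

/-- The universal `R`-matrix `R = g^{a+b} ⊗ g^{-a-b}` of `k[⟨g⟩]^{a,b}_q`. -/
noncomputable def cyclicQuasiTriangular (q : kˣ) (a b : ℤ) :
    QuasiTriangular (cyclicQuasiBialgebra k q a b) where
  R := tmulUnit k (genPow k (a + b)) (genPow k (-a - b))
  hexagon₁ := by
    have e : genPow k (-a - b) = genPow k a * genPow k (-a - b) * genPow k (-a - b) *
        genPow k b := by
      simp only [← genPow_add]; congr 1; ring
    have e' := congrArg Units.val e
    simp only [Units.val_mul] at e'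
    simp [cyclicQuasiBialgebra, rotate, ← e']
  hexagon₂ := by
    have e : genPow k (a + b) = (genPow k b)⁻¹ * genPow k (a + b) * genPow k (a + b) *
        (genPow k a)⁻¹ := by
      simp only [genPow_neg, ← genPow_add]; congr 1; ring
    have e' := congrArg Units.val e
    simp only [Units.val_mul] at e'
    simp [cyclicQuasiBialgebra, rotate, ← e']
  almost_cocomm h := by
    rw [Units.eq_mul_inv_iff_mul_eq]
    refine (mul_comm (G := CyclicGroupAlgebra k ⊗[k] CyclicGroupAlgebra k) _ _).trans ?_
    congr 1
    exact Coalgebra.comm_comul k h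

theorem cyclicQuasiTriangular_triangular (q : kˣ) (a b : ℤ) :
    Algebra.TensorProduct.comm k _ _ ((cyclicQuasiTriangular k q a b).R :
      CyclicGroupAlgebra k ⊗[k] CyclicGroupAlgebra k) =
    (↑(cyclicQuasiTriangular k q a b).R⁻¹ : CyclicGroupAlgebra k ⊗[k] CyclicGroupAlgebra k) := by
  have e1 : -(a + b) = -a - b := by ring
  have e2 : -(-a - b) = a + b := by ring
  simp only [cyclicQuasiTriangular, val_tmulUnit, val_inv_tmulUnit, genPow_neg, e1, e2,
    Algebra.TensorProduct.comm_tmul]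

/-- The symmetric category of left modules over the triangular quasi-bialgebra
`k[⟨g⟩]^{a,b}_q`. -/
@[reducible]
noncomputable def cyclicSymmetricCategory (q : kˣ) (a b : ℤ) :
    @SymmetricCategory (LeftMod k (CyclicGroupAlgebra k)) _
      (cyclicQuasiBialgebra k q a b).monoidalCategory :=
  (cyclicQuasiTriangular k q a b).symmetricCategory (cyclicQuasiTriangular_triangular k q a b)

/-- The functor `W` from left `k[⟨g⟩]`-modules to `H(Vect)`, `(X, μ_X) ↦ (X, f_X)` with
`f_X x = g x`, and the identity on morphisms. -/
noncomputable def functorW : LeftMod k (CyclicGroupAlgebra k) ⥤ HomCat (ModuleCat.{u} k) where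
  obj X := ⟨X.obj, (actUnit X.act (genPow k 1)).toModuleIso⟩
  map f := ⟨f.hom, by ext x; exact (f.comm _ x)⟩

end Laurent

/-! The argument rests on Yoneda and on the trivial units of Laurent polynomial rings. The space
with basis `ℤ` and the shift, `regularObj`, represents the forgetful functor: a morphism from it to
`(X, f_X)` is the choice of a vector of `X`. A natural automorphism of `X ⊗ Y`, or of a similar
tensor expression, is therefore determined by its value on the generator of the regular objects, and
there it commutes with all translations of the basis. It acts as multiplication by a unit of a
Laurent polynomial ring in one, two or three variables. Over a field such a unit is a scalar times a
monomial (`exists_apply_basis_zero_eq_smul`), because `ℤ`, `ℤ²` and `ℤ³` have two unique sums. So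
every natural automorphism in play has the form `c • (f_X^i ⊗ f_Y^j ⊗ ...)`.

For an induced monoidal structure this leaves finitely many scalars and exponents. Since the unit
constraints are morphisms of the Hom-category, `f_{X⊗Y} = d⁻¹ f_X ⊗ f_Y`, where `d` is the scalar of
the unit object (`exponents_eq_one`). The pentagon kills the middle exponent of the associator and
fixes its scalar, and the triangle ties the unit constraints to the associator
(`exists_hasParameters`). What survives is `d, q, a, b`. The functor `(X, f_X) ↦ (X, d⁻¹ f_X)`
replaces `d` by `1`, which gives the isomorphism with `homStructure`. When `d = 1` already, the
structures coincide, and `q, a, b` can be read off from the constraints.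

A braiding followed by the flip is again a natural automorphism of `X ⊗ Y`, and the two hexagons
determine its scalar and its two exponents (`homStructure_braiding_apply`). Finally, a module over
the group algebra of `⟨g⟩` is a space with an automorphism, and `g^n` acts as the `n`-th power of it
(`LeftMod.toHomCat_pow`), so `W` carries the constraints given by `φ`, `λ`, `ρ` and `R` to those of
`homStructure`. -/

/-! ### Automorphisms commuting with translations, and trivial units. -/

/-- An automorphism of a free module with basis indexed by a group `G` with unique sums which
commutes with the translations by `G` is monomial: it multiplies by a trivial unit. -/
theorem exists_apply_basis_zero_eq_smul {k M G : Type*} [Field k] [AddCommGroup M] [Module k M]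
    [AddCommGroup G] [TwoUniqueSums G] (b : Module.Basis G k M) (θ : M ≃ₗ[k] M)
    (s : G → Module.End k M) (hs : ∀ g h, s g (b h) = b (g + h))
    (hθ : ∀ g m, θ (s g m) = s g (θ m)) : ∃ (c : kˣ) (g : G), θ (b 0) = (c : k) • b g := by
  classical
  set p := b.repr (θ (b 0)) with hp
  set q := b.repr (θ.symm (b 0)) with hq
  have hp' : θ (b 0) = ∑ g ∈ p.support, p g • b g := (b.linearCombination_repr _).symm
  have hq' : θ.symm (b 0) = ∑ h ∈ q.support, q h • b h := (b.linearCombination_repr _).symm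
  -- The elements of the group algebra with coefficients `q` and `p` have product `1`: expand `θ
  -- (θ⁻¹ (b 0))`, moving the translations through `θ`.
  have key : b 0 = ∑ h ∈ q.support, ∑ g ∈ p.support, (q h * p g) • b (h + g) := by
    conv_lhs => rw [← θ.apply_symm_apply (b 0), hq', map_sum]
    refine Finset.sum_congr rfl fun h _ => ?_
    have e : b h = s h (b 0) := by rw [hs, add_zero]
    rw [map_smul, e, hθ, hp', map_sum, Finset.smul_sum]
    exact Finset.sum_congr rfl fun g _ => by rw [map_smul, hs, smul_smul]
  -- At a sum attained only once, the coefficient of the product is a single term `q h * p g`, which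
  -- is nonzero. As the product is `b 0`, that sum must be `0`.
  have coeff : ∀ t ∈ q.support ×ˢ p.support, UniqueAdd q.support p.support t.1 t.2 →
      t.1 + t.2 = 0 := by
    rintro ⟨h, g⟩ ht hu
    rw [Finset.mem_product] at ht
    by_contra hne
    have h0 := congrArg (fun m => b.repr m (h + g)) key
    simp only [map_sum, map_smul, b.repr_self, Finsupp.coe_finsetSum, Finset.sum_apply,
      Finsupp.smul_apply, smul_eq_mul] at h0
    rw [Finsupp.single_eq_of_ne hne,
      Finset.sum_eq_single_of_mem h ht.1 (fun h' hh' hne' => Finset.sum_eq_zero fun g' hg' => by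
        rw [Finsupp.single_eq_of_ne, mul_zero]
        exact fun he => hne' (hu hh' hg' he.symm).1),
      Finset.sum_eq_single_of_mem g ht.2 (fun g' hg' hne' => by
        rw [Finsupp.single_eq_of_ne, mul_zero]
        exact fun he => hne' (hu ht.1 hg' he.symm).2),
      Finsupp.single_eq_same, mul_one] at h0
    exact mul_ne_zero (Finsupp.mem_support_iff.1 ht.1) (Finsupp.mem_support_iff.1 ht.2) h0.symm
  have hcard : q.support.card * p.support.card ≤ 1 := by
    by_contra! hlt
    -- Two different pairs with unique sums would both have sum `0`, against the uniqueness of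
    -- either.
    obtain ⟨t₁, h₁, t₂, h₂, hne, hu₁, hu₂⟩ := TwoUniqueSums.uniqueAdd_of_one_lt_card hlt
    have h := hu₂ (Finset.mem_product.1 h₁).1 (Finset.mem_product.1 h₁).2
      ((coeff _ h₁ hu₁).trans (coeff _ h₂ hu₂).symm)
    exact hne (Prod.ext h.1 h.2)
  have hp0 : p.support.card ≠ 0 := by
    rw [Ne, Finset.card_eq_zero, Finsupp.support_eq_empty, hp, LinearEquiv.map_eq_zero_iff,
      LinearEquiv.map_eq_zero_iff]
    exact b.ne_zero 0
  have hq0 : q.support.card ≠ 0 := by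
    rw [Ne, Finset.card_eq_zero, Finsupp.support_eq_empty, hq, LinearEquiv.map_eq_zero_iff,
      LinearEquiv.map_eq_zero_iff]
    exact b.ne_zero 0
  have hp1 : p.support.card = 1 := by
    have := Nat.le_mul_of_pos_left p.support.card (Nat.pos_of_ne_zero hq0)
    omega
  obtain ⟨g, hg⟩ := Finset.card_eq_one.1 hp1
  have hg' : p g ≠ 0 := Finsupp.mem_support_iff.1 (hg ▸ Finset.mem_singleton_self g)
  refine ⟨Units.mk0 (p g) hg', g, ?_⟩
  rw [hp', hg, Finset.sum_singleton, Units.val_mk0]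

/-- Evaluating an axiom at basis vectors of the regular object yields an equation between multiples
of basis vectors; this splits it into an equation of scalars and one of exponents. -/
theorem smul_basis_inj {k M G : Type*} [Field k] [AddCommGroup M] [Module k M]
    (b : Module.Basis G k M) {c c' : kˣ} {g g' : G} (h : (c : k) • b g = (c' : k) • b g') :
    c = c' ∧ g = g' := by
  have h := congrArg b.repr h
  simp only [map_smul, b.repr_self, Finsupp.smul_single, smul_eq_mul, mul_one] at h
  rcases (Finsupp.single_eq_single_iff _ _ _ _).1 h with h | h
  · exact ⟨Units.ext h.2, h.1⟩
  · exact absurd h.1 c.ne_zero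

/-- Knowledge of `f_X` along a `ℤ`-indexed orbit determines all integer powers there. Each closed
formula for `pow` below comes from guessing the orbit and checking one application of `f_X`. -/
theorem HomCat.pow_orbit {k : Type u} [Field k] (X : HomCat (ModuleCat.{u} k)) (v : ℤ → X.obj)
    (h : ∀ n, X.aut.hom.hom (v n) = v (1 + n)) (m n : ℤ) : X.pow m (v n) = v (m + n) := by
  induction m generalizing n with
  | zero => rw [HomCat.pow_zero_apply, zero_add]
  | succ m ih => rw [HomCat.pow_add_apply, HomCat.pow_one_apply, h, ih, add_assoc]
  | pred m ih =>
    -- The hypothesis only shifts forward, so the negative case is compared after one further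
    -- application of `f_X`.
    apply (X.pow 1).injective
    rw [← HomCat.pow_add_apply, HomCat.pow_one_apply, h, add_sub_cancel, ih]
    congr 1
    ring

/-! ### The regular object and natural automorphisms. -/

section Regular

variable (k : Type u) [Field k]

/-- The regular object of `H(Vect)`: the space with basis `ℤ` and the shift `n ↦ 1 + n`. -/
noncomputable def regularObj : HomCat (ModuleCat.{u} k) :=
  ⟨ModuleCat.of k (ℤ →₀ k), (Finsupp.domLCongr (Equiv.addLeft (1 : ℤ))).toModuleIso⟩

noncomputable def regularBasis : Module.Basis ℤ k (regularObj k).obj :=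
  (Finsupp.basisSingleOne : Module.Basis ℤ k (ℤ →₀ k))

theorem regularObj_pow_basis (m n : ℤ) :
    (regularObj k).pow m (regularBasis k n) = regularBasis k (m + n) := by
  refine (regularObj k).pow_orbit _ (fun n => ?_) m n
  change Finsupp.domLCongr (Equiv.addLeft (1 : ℤ))
    ((Finsupp.basisSingleOne : Module.Basis ℤ k (ℤ →₀ k)) n) =
      (Finsupp.basisSingleOne : Module.Basis ℤ k (ℤ →₀ k)) (1 + n)
  simp

variable {k}

/-- The morphism from the regular object sending the generator to `x`. -/
noncomputable def evalHom (X : HomCat (ModuleCat.{u} k)) (x : X.obj) : regularObj k ⟶ X where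
  hom := ModuleCat.ofHom ((regularBasis k).constr k fun n => X.pow n x)
  comm := by
    apply ModuleCat.hom_ext
    apply (regularBasis k).ext
    intro n
    change (regularBasis k).constr k (fun n => X.pow n x)
        ((regularObj k).aut.hom (regularBasis k n)) =
      X.aut.hom ((regularBasis k).constr k (fun n => X.pow n x) (regularBasis k n))
    rw [← HomCat.pow_one_apply, ← HomCat.pow_one_apply, regularObj_pow_basis,
      Module.Basis.constr_basis, Module.Basis.constr_basis, HomCat.pow_add_apply]

theorem evalHom_basis (X : HomCat (ModuleCat.{u} k)) (x : X.obj) (n : ℤ) :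
    (evalHom X x).hom.hom (regularBasis k n) = X.pow n x :=
  (regularBasis k).constr_basis k _ n

/-- Translations of the basis are endomorphisms of the regular object, so naturality includes
commutation with them. -/
theorem evalHom_regular_basis (m n : ℤ) :
    (evalHom (regularObj k) (regularBasis k m)).hom.hom (regularBasis k n) =
      regularBasis k (m + n) := by
  rw [evalHom_basis, regularObj_pow_basis, add_comm]

/-- Natural automorphisms of the forgetful functor of `H(Vect)`. -/
theorem exists_natural_apply_eq
    (θ : ∀ X : HomCat (ModuleCat.{u} k), X.obj ≃ₗ[k] X.obj)
    (hθ : ∀ {X X' : HomCat (ModuleCat.{u} k)} (f : X ⟶ X') (x : X.obj),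
      θ X' (f.hom.hom x) = f.hom.hom (θ X x)) :
    ∃ (c : kˣ) (i : ℤ), ∀ (X : HomCat (ModuleCat.{u} k)) (x : X.obj),
      θ X x = (c : k) • X.pow i x := by
  obtain ⟨c, i, h⟩ := exists_apply_basis_zero_eq_smul (regularBasis k) (θ (regularObj k))
    (fun g => (evalHom (regularObj k) (regularBasis k g)).hom.hom)
    (fun g h => evalHom_regular_basis g h) (fun g m => hθ _ m)
  refine ⟨c, i, fun X x => ?_⟩
  -- Yoneda: `x` is the image of the generator under `evalHom X x`, so the value at `x` is the image
  -- of the value at the generator.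
  have e := hθ (evalHom X x) (regularBasis k 0)
  rwa [h, map_smul, evalHom_basis, evalHom_basis, HomCat.pow_zero_apply] at e

/-- Natural automorphisms of `X ⊗ Y`. -/
theorem exists_natural_tmul_eq
    (θ : ∀ X Y : HomCat (ModuleCat.{u} k), X.obj ⊗[k] Y.obj ≃ₗ[k] X.obj ⊗[k] Y.obj)
    (hθ : ∀ {X X' Y Y' : HomCat (ModuleCat.{u} k)} (f : X ⟶ X') (g : Y ⟶ Y')
      (t : X.obj ⊗[k] Y.obj), θ X' Y' (TensorProduct.map f.hom.hom g.hom.hom t) =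
        TensorProduct.map f.hom.hom g.hom.hom (θ X Y t)) :
    ∃ (c : kˣ) (i j : ℤ), ∀ (X Y : HomCat (ModuleCat.{u} k)) (x : X.obj) (y : Y.obj),
      θ X Y (x ⊗ₜ y) = (c : k) • (X.pow i x ⊗ₜ Y.pow j y) := by
  let β := regularBasis k
  let ev : ℤ → (regularObj k ⟶ regularObj k) := fun g => evalHom (regularObj k) (β g)
  -- The tensor square of the regular object has a basis indexed by `ℤ × ℤ`, and its translations
  -- are tensor products of endomorphisms of the factors.
  obtain ⟨c, ⟨i, j⟩, h⟩ := exists_apply_basis_zero_eq_smul (β.tensorProduct β)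
    (θ (regularObj k) (regularObj k))
    (fun g => TensorProduct.map (ev g.1).hom.hom (ev g.2).hom.hom)
    (fun g h => by
      simp only [Module.Basis.tensorProduct_apply', TensorProduct.map_tmul, Prod.fst_add,
        Prod.snd_add, β, ev, evalHom_regular_basis])
    (fun g m => hθ _ _ m)
  refine ⟨c, i, j, fun X Y x y => ?_⟩
  have e := hθ (evalHom X x) (evalHom Y y) (β 0 ⊗ₜ β 0)
  rw [Module.Basis.tensorProduct_apply', Module.Basis.tensorProduct_apply'] at h
  rw [show β 0 ⊗ₜ[k] β 0 = β (0 : ℤ × ℤ).1 ⊗ₜ[k] β (0 : ℤ × ℤ).2 from rfl, h] at e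
  simpa only [map_smul, TensorProduct.map_tmul, β, evalHom_basis, Prod.fst_zero, Prod.snd_zero,
    HomCat.pow_zero_apply] using e

/-- Natural automorphisms of `X ⊗ (Y ⊗ Z)`. -/
theorem exists_natural_tmul_tmul_eq
    (θ : ∀ X Y Z : HomCat (ModuleCat.{u} k),
      X.obj ⊗[k] (Y.obj ⊗[k] Z.obj) ≃ₗ[k] X.obj ⊗[k] (Y.obj ⊗[k] Z.obj))
    (hθ : ∀ {X X' Y Y' Z Z' : HomCat (ModuleCat.{u} k)} (f : X ⟶ X') (g : Y ⟶ Y') (h : Z ⟶ Z')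
      (t : X.obj ⊗[k] (Y.obj ⊗[k] Z.obj)),
        θ X' Y' Z' (TensorProduct.map f.hom.hom (TensorProduct.map g.hom.hom h.hom.hom) t) =
        TensorProduct.map f.hom.hom (TensorProduct.map g.hom.hom h.hom.hom) (θ X Y Z t)) :
    ∃ (c : kˣ) (i j l : ℤ), ∀ (X Y Z : HomCat (ModuleCat.{u} k)) (x : X.obj) (y : Y.obj)
      (z : Z.obj), θ X Y Z (x ⊗ₜ (y ⊗ₜ z)) =
        (c : k) • (X.pow i x ⊗ₜ (Y.pow j y ⊗ₜ Z.pow l z)) := by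
  let β := regularBasis k
  let ev : ℤ → (regularObj k ⟶ regularObj k) := fun g => evalHom (regularObj k) (β g)
  obtain ⟨c, ⟨i, j, l⟩, h⟩ := exists_apply_basis_zero_eq_smul
    (β.tensorProduct (β.tensorProduct β))
    (θ (regularObj k) (regularObj k) (regularObj k))
    (fun g => TensorProduct.map (ev g.1).hom.hom
      (TensorProduct.map (ev g.2.1).hom.hom (ev g.2.2).hom.hom))
    (fun g h => by
      simp only [Module.Basis.tensorProduct_apply', TensorProduct.map_tmul, Prod.fst_add,
        Prod.snd_add, β, ev, evalHom_regular_basis])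
    (fun g m => hθ _ _ _ m)
  refine ⟨c, i, j, l, fun X Y Z x y z => ?_⟩
  have e := hθ (evalHom X x) (evalHom Y y) (evalHom Z z) (β 0 ⊗ₜ (β 0 ⊗ₜ β 0))
  simp only [Module.Basis.tensorProduct_apply', Prod.fst_zero, Prod.snd_zero] at h
  rw [h] at e
  simpa only [map_smul, TensorProduct.map_tmul, β, evalHom_basis,
    HomCat.pow_zero_apply] using e

end Regular

/-! ### The form of an induced monoidal structure. -/

section Classification

variable {k : Type u} [Field k]

theorem exists_unit_apply_eq_mul (f : k ≃ₗ[k] k) : ∃ d : kˣ, ∀ κ : k, f κ = (d : k) * κ := by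
  refine ⟨Units.mk0 (f 1) fun h => one_ne_zero (f.map_eq_zero_iff.1 h), fun κ => ?_⟩
  rw [Units.val_mk0, mul_comm, ← smul_eq_mul, ← map_smul, smul_eq_mul, mul_one]

/-- Each application of the automorphism of a tensor product contributes one factor `d⁻¹`. These
powers of `d` enter the pentagon whenever an argument of the associator is itself a tensor product.
-/
theorem InducedTensor.pow_tmul (T : InducedTensor (ModuleCat.{u} k)) (d : kˣ)
    (hT : ∀ (X Y : HomCat (ModuleCat.{u} k)) (x : X.obj) (y : Y.obj),
      (T.tensorAut X Y).hom.hom (x ⊗ₜ[k] y) =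
        ((d⁻¹ : kˣ) : k) • (X.aut.hom.hom x ⊗ₜ[k] Y.aut.hom.hom y : X.obj ⊗[k] Y.obj))
    (X Y : HomCat (ModuleCat.{u} k)) (n : ℤ) (x : X.obj) (y : Y.obj) :
    (T.tensorObj X Y).pow n (x ⊗ₜ[k] y : X.obj ⊗[k] Y.obj) =
      ((d ^ (-n) : kˣ) : k) • (X.pow n x ⊗ₜ[k] Y.pow n y : X.obj ⊗[k] Y.obj) := by
  have h := (T.tensorObj X Y).pow_orbit
    (fun n => (((d ^ (-n) : kˣ) : k) • (X.pow n x ⊗ₜ[k] Y.pow n y) : X.obj ⊗[k] Y.obj))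
    (fun n => by
      refine ((T.tensorAut X Y).hom.hom.map_smul ((d ^ (-n) : kˣ) : k)
        (X.pow n x ⊗ₜ[k] Y.pow n y : X.obj ⊗[k] Y.obj)).trans ?_
      rw [hT, HomCat.pow_add_apply X, HomCat.pow_add_apply Y, HomCat.pow_one_apply,
        HomCat.pow_one_apply, neg_add_rev, zpow_add, zpow_neg_one, Units.val_mul]
      exact smul_smul _ _ (X.aut.hom.hom (X.pow n x) ⊗ₜ[k] Y.aut.hom.hom (Y.pow n y) :
        X.obj ⊗[k] Y.obj)) n 0
  simpa using h

namespace InducedMonoidal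

/-- The form of an induced monoidal structure on `H(Vect)` whose unit object is `(k, d)`. -/
structure HasParameters (S : InducedMonoidal (ModuleCat.{u} k)) (d q : kˣ) (a b : ℤ) : Prop where
  tensorAut : ∀ (X Y : HomCat (ModuleCat.{u} k)) (x : X.obj) (y : Y.obj),
    (S.tensorAut X Y).hom.hom (x ⊗ₜ[k] y) =
      ((d⁻¹ : kˣ) : k) • (X.aut.hom.hom x ⊗ₜ[k] Y.aut.hom.hom y : X.obj ⊗[k] Y.obj)
  unitAut : ∀ κ : k, S.unitAut.hom.hom κ = (d : k) * κ
  -- The powers of `d` in the constraints are those produced by writing `(d⁻¹ f_X)^n` for `f_X^n` in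
  -- the constraints of `homStructure`; thus `q, a, b` are the parameters after rescaling.
  associator : ∀ (X Y Z : HomCat (ModuleCat.{u} k)) (x : X.obj) (y : Y.obj) (z : Z.obj),
    (S.associator X Y Z).hom.hom.hom ((x ⊗ₜ[k] y) ⊗ₜ[k] z) =
      ((d ^ (-a - b) : kˣ) : k) •
        (X.pow a x ⊗ₜ[k] (y ⊗ₜ[k] Z.pow b z) : X.obj ⊗[k] (Y.obj ⊗[k] Z.obj))
  leftUnitor : ∀ (X : HomCat (ModuleCat.{u} k)) (κ : k) (x : X.obj),
    (S.leftUnitor X).hom.hom.hom (κ ⊗ₜ[k] x) = ((q * d ^ b : kˣ) : k) • X.pow (-b) (κ • x)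
  rightUnitor : ∀ (X : HomCat (ModuleCat.{u} k)) (κ : k) (x : X.obj),
    (S.rightUnitor X).hom.hom.hom (x ⊗ₜ[k] κ) = ((q * d ^ (-a) : kˣ) : k) • X.pow a (κ • x)

variable (S : InducedMonoidal (ModuleCat.{u} k))

theorem exists_tensorAut : ∃ (c : kˣ) (i j : ℤ),
    ∀ (X Y : HomCat (ModuleCat.{u} k)) (x : X.obj) (y : Y.obj),
      (S.tensorAut X Y).hom.hom (x ⊗ₜ[k] y) =
        (c : k) • (X.pow i x ⊗ₜ[k] Y.pow j y : X.obj ⊗[k] Y.obj) :=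
  exists_natural_tmul_eq (fun X Y => (S.tensorAut X Y).toLinearEquiv)
    fun f g t => (congrArg (fun φ => φ.hom t) (S.tensor_comm f g)).symm

theorem exists_unitAut : ∃ d : kˣ, ∀ κ : k, S.unitAut.hom.hom κ = (d : k) * κ :=
  exists_unit_apply_eq_mul S.unitAut.toLinearEquiv

/-- Composed with the inverse of the associativity isomorphism of vector spaces, the associator
becomes a natural automorphism of `X ⊗ (Y ⊗ Z)`. -/
theorem exists_associator : ∃ (c : kˣ) (i j l : ℤ),
    ∀ (X Y Z : HomCat (ModuleCat.{u} k)) (x : X.obj) (y : Y.obj) (z : Z.obj),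
      (S.associator X Y Z).hom.hom.hom ((x ⊗ₜ[k] y) ⊗ₜ[k] z) =
        (c : k) • (X.pow i x ⊗ₜ[k] (Y.pow j y ⊗ₜ[k] Z.pow l z) :
          X.obj ⊗[k] (Y.obj ⊗[k] Z.obj)) := by
  obtain ⟨c, i, j, l, h⟩ := exists_natural_tmul_tmul_eq
    (fun X Y Z => (TensorProduct.assoc k X.obj Y.obj Z.obj).symm ≪≫ₗ
      ((HomCat.forget _).mapIso (S.associator X Y Z)).toLinearEquiv)
    (fun {X X' Y Y' Z Z'} f g h t => by
      have e := congrArg (fun φ => φ.hom.hom ((TensorProduct.assoc k X.obj Y.obj Z.obj).symm t))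
        (S.associator_naturality f g h)
      refine Eq.trans ?_ e
      change (S.associator X' Y' Z').hom.hom.hom _ = (S.associator X' Y' Z').hom.hom.hom _
      congr 1
      exact (TensorProduct.map_map_assoc_symm f.hom.hom g.hom.hom h.hom.hom t).symm)
  exact ⟨c, i, j, l, fun X Y Z x y z => h X Y Z x y z⟩

/-- Precomposition with `x ↦ 1 ⊗ x` turns the unit constraint into a natural automorphism of the
forgetful functor. -/
theorem exists_leftUnitor : ∃ (c : kˣ) (i : ℤ),
    ∀ (X : HomCat (ModuleCat.{u} k)) (κ : k) (x : X.obj),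
      (S.leftUnitor X).hom.hom.hom (κ ⊗ₜ[k] x) = (c : k) • X.pow i (κ • x) := by
  obtain ⟨c, i, h⟩ := exists_natural_apply_eq
    (fun X => (TensorProduct.lid k X.obj).symm ≪≫ₗ
      ((HomCat.forget _).mapIso (S.leftUnitor X)).toLinearEquiv)
    (fun {X X'} f x => congrArg (fun φ => φ.hom.hom ((1 : k) ⊗ₜ[k] x))
      (S.leftUnitor_naturality f))
  refine ⟨c, i, fun X κ x => Eq.trans ?_ (h X (κ • x))⟩
  refine congrArg (S.leftUnitor X).hom.hom.hom (?_ : κ ⊗ₜ[k] x = (1 : k) ⊗ₜ[k] (κ • x))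
  rw [← TensorProduct.smul_tmul, smul_eq_mul, mul_one]

theorem exists_rightUnitor : ∃ (c : kˣ) (i : ℤ),
    ∀ (X : HomCat (ModuleCat.{u} k)) (κ : k) (x : X.obj),
      (S.rightUnitor X).hom.hom.hom (x ⊗ₜ[k] κ) = (c : k) • X.pow i (κ • x) := by
  obtain ⟨c, i, h⟩ := exists_natural_apply_eq
    (fun X => (TensorProduct.rid k X.obj).symm ≪≫ₗ
      ((HomCat.forget _).mapIso (S.rightUnitor X)).toLinearEquiv)
    (fun {X X'} f x => congrArg (fun φ => φ.hom.hom (x ⊗ₜ[k] (1 : k)))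
      (S.rightUnitor_naturality f))
  refine ⟨c, i, fun X κ x => Eq.trans ?_ (h X (κ • x))⟩
  refine congrArg (S.rightUnitor X).hom.hom.hom (?_ : x ⊗ₜ[k] κ = (κ • x) ⊗ₜ[k] (1 : k))
  rw [TensorProduct.smul_tmul, smul_eq_mul, mul_one]


/-- The unit constraints intertwine the automorphism of `k ⊗ X`, or of `X ⊗ k`, with `f_X`. On the
regular object both sides are multiples of basis vectors: comparing exponents gives `j = 1` from the
left constraint and `i = 1` from the right one. As `i = 1`, the power of the automorphism of `k`
that occurs on the left is multiplication by `d`, and comparing scalars gives `c * d = 1`. -/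
theorem exponents_eq_one {c d : kˣ} {i j : ℤ}
    (hT : ∀ (X Y : HomCat (ModuleCat.{u} k)) (x : X.obj) (y : Y.obj),
      (S.tensorAut X Y).hom.hom (x ⊗ₜ[k] y) =
        (c : k) • (X.pow i x ⊗ₜ[k] Y.pow j y : X.obj ⊗[k] Y.obj))
    (hd : ∀ κ : k, S.unitAut.hom.hom κ = (d : k) * κ) : i = 1 ∧ j = 1 ∧ c = d⁻¹ := by
  set β := regularBasis k
  obtain ⟨r, s, hL⟩ := S.exists_leftUnitor
  obtain ⟨r', n, hR⟩ := S.exists_rightUnitor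
  -- Powers of the automorphism of `k` are scalars; `e` is identified with `d` only once `i = 1` is
  -- known.
  obtain ⟨e, he⟩ := exists_unit_apply_eq_mul (S.unitObj.pow i)
  obtain ⟨e', he'⟩ := exists_unit_apply_eq_mul (S.unitObj.pow j)
  have h1 : (S.leftUnitor (regularObj k)).hom.hom.hom
      ((S.tensorAut S.unitObj (regularObj k)).hom.hom ((1 : k) ⊗ₜ[k] β 0)) =
      (regularObj k).aut.hom ((S.leftUnitor (regularObj k)).hom.hom.hom ((1 : k) ⊗ₜ[k] β 0)) :=
    congrArg (fun φ => φ.hom ((1 : k) ⊗ₜ[k] β 0)) (S.leftUnitor (regularObj k)).hom.comm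
  have h2 : (S.rightUnitor (regularObj k)).hom.hom.hom
      ((S.tensorAut (regularObj k) S.unitObj).hom.hom (β 0 ⊗ₜ[k] (1 : k))) =
      (regularObj k).aut.hom ((S.rightUnitor (regularObj k)).hom.hom.hom (β 0 ⊗ₜ[k] (1 : k))) :=
    congrArg (fun φ => φ.hom (β 0 ⊗ₜ[k] (1 : k))) (S.rightUnitor (regularObj k)).hom.comm
  rw [hL, ← HomCat.pow_one_apply, one_smul, map_smul, regularObj_pow_basis,
    regularObj_pow_basis, hT, he, regularObj_pow_basis, map_smul, hL, mul_one, map_smul,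
    regularObj_pow_basis, smul_smul, smul_smul, ← Units.val_mul, ← Units.val_mul] at h1
  rw [hR, ← HomCat.pow_one_apply, one_smul, map_smul, regularObj_pow_basis,
    regularObj_pow_basis, hT, he', regularObj_pow_basis, map_smul, hR, mul_one, map_smul,
    regularObj_pow_basis, smul_smul, smul_smul, ← Units.val_mul, ← Units.val_mul] at h2
  obtain ⟨h1, hj⟩ := smul_basis_inj _ h1
  obtain ⟨-, hi⟩ := smul_basis_inj _ h2
  have hi : i = 1 := by omega
  refine ⟨hi, by omega, ?_⟩
  have hde : d = e := by
    have h := he 1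
    rw [hi, HomCat.pow_one_apply] at h
    have h' := (hd 1).symm.trans h
    rw [mul_one, mul_one] at h'
    exact Units.ext h'
  rw [mul_right_comm, mul_eq_right] at h1
  rw [hde]
  exact eq_inv_of_mul_eq_one_left h1

/-- It suffices to evaluate the pentagon and the triangle at the generators of regular objects,
where both sides are a scalar times a basis vector. -/
theorem exists_hasParameters : ∃ (d q : kˣ) (a b : ℤ), S.HasParameters d q a b := by
  set β := regularBasis k
  obtain ⟨c, i, j, hT⟩ := S.exists_tensorAut
  obtain ⟨d, hd⟩ := S.exists_unitAut
  obtain ⟨p, a, e, b, hA⟩ := S.exists_associator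
  obtain ⟨r, s, hL⟩ := S.exists_leftUnitor
  obtain ⟨r', n, hR⟩ := S.exists_rightUnitor
  obtain ⟨rfl, rfl, rfl⟩ := S.exponents_eq_one hT hd
  replace hT : ∀ (X Y : HomCat (ModuleCat.{u} k)) (x : X.obj) (y : Y.obj),
      (S.tensorAut X Y).hom.hom (x ⊗ₜ[k] y) =
        ((d⁻¹ : kˣ) : k) • (X.aut.hom.hom x ⊗ₜ[k] Y.aut.hom.hom y : X.obj ⊗[k] Y.obj) :=
    fun X Y x y => by rw [hT, HomCat.pow_one_apply, HomCat.pow_one_apply]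
  have hP := S.pow_tmul d hT
  let R := regularObj k
  -- `A₁`, `A₂` and `A₃` are the associators with a tensor product in the middle, left or right
  -- slot; the slot decides whether the extra factor is `d^(-e)`, `d^(-a)` or `d^(-b)`.
  have A₁ : ∀ u v w x : R.obj,
      (S.associator R (S.tensorObj R R) R).hom.hom.hom ((u ⊗ₜ[k] (v ⊗ₜ[k] w)) ⊗ₜ[k] x) =
        ((p * d ^ (-e) : kˣ) : k) • (R.pow a u ⊗ₜ[k] ((R.pow e v ⊗ₜ[k] R.pow e w) ⊗ₜ[k]
          R.pow b x) : R.obj ⊗[k] ((R.obj ⊗[k] R.obj) ⊗[k] R.obj)) := fun u v w x => by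
    refine (hA R (S.tensorObj R R) R u (v ⊗ₜ[k] w) x).trans ?_
    rw [hP, Units.val_mul, mul_smul]
    congr 1
    change R.pow a u ⊗ₜ[k] ((((d ^ (-e) : kˣ) : k) • (R.pow e v ⊗ₜ[k] R.pow e w)) ⊗ₜ[k]
      R.pow b x) = _
    rw [← TensorProduct.smul_tmul', TensorProduct.tmul_smul]
  have A₂ : ∀ u v w x : R.obj,
      (S.associator (S.tensorObj R R) R R).hom.hom.hom (((u ⊗ₜ[k] v) ⊗ₜ[k] w) ⊗ₜ[k] x) =
        ((p * d ^ (-a) : kˣ) : k) • ((R.pow a u ⊗ₜ[k] R.pow a v) ⊗ₜ[k] (R.pow e w ⊗ₜ[k]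
          R.pow b x) : (R.obj ⊗[k] R.obj) ⊗[k] (R.obj ⊗[k] R.obj)) := fun u v w x => by
    refine (hA (S.tensorObj R R) R R (u ⊗ₜ[k] v) w x).trans ?_
    rw [hP, Units.val_mul, mul_smul]
    rfl
  have A₃ : ∀ u v w x : R.obj,
      (S.associator R R (S.tensorObj R R)).hom.hom.hom ((u ⊗ₜ[k] v) ⊗ₜ[k] (w ⊗ₜ[k] x)) =
        ((p * d ^ (-b) : kˣ) : k) • (R.pow a u ⊗ₜ[k] (R.pow e v ⊗ₜ[k] (R.pow b w ⊗ₜ[k]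
          R.pow b x)) : R.obj ⊗[k] (R.obj ⊗[k] (R.obj ⊗[k] R.obj))) := fun u v w x => by
    refine (hA R R (S.tensorObj R R) u v (w ⊗ₜ[k] x)).trans ?_
    rw [hP, Units.val_mul, mul_smul]
    congr 1
    change R.pow a u ⊗ₜ[k] (R.pow e v ⊗ₜ[k] (((d ^ (-b) : kˣ) : k) • (R.pow b w ⊗ₜ[k]
      R.pow b x))) = _
    rw [TensorProduct.tmul_smul, TensorProduct.tmul_smul]
  have hpent := congrArg (fun φ => φ.hom.hom (((β 0 ⊗ₜ[k] β 0) ⊗ₜ[k] β 0) ⊗ₜ[k] β 0))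
    (S.pentagon R R R R)
  change TensorProduct.map LinearMap.id (S.associator R R R).hom.hom.hom
    ((S.associator R (S.tensorObj R R) R).hom.hom.hom
      (TensorProduct.map (S.associator R R R).hom.hom.hom LinearMap.id
        (((β 0 ⊗ₜ[k] β 0) ⊗ₜ[k] β 0) ⊗ₜ[k] β 0))) =
    (S.associator R R (S.tensorObj R R)).hom.hom.hom
      ((S.associator (S.tensorObj R R) R R).hom.hom.hom
        (((β 0 ⊗ₜ[k] β 0) ⊗ₜ[k] β 0) ⊗ₜ[k] β 0)) at hpent
  rw [A₂, map_smul, A₃, TensorProduct.map_tmul, hA, ← TensorProduct.smul_tmul', map_smul, A₁,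
    map_smul, map_smul, TensorProduct.map_tmul, hA, TensorProduct.tmul_smul] at hpent
  simp only [LinearMap.id_apply, R, β, regularObj_pow_basis, smul_smul, ← Units.val_mul,
    ← Module.Basis.tensorProduct_apply] at hpent
  obtain ⟨hp, hexp⟩ := smul_basis_inj _ hpent
  simp only [Prod.mk.injEq] at hexp
  -- The second factor receives the exponent `a + 2e` on one side of the pentagon and `a + e` on the
  -- other.
  have he : e = 0 := by omega
  subst he
  have htri := congrArg (fun φ => φ.hom.hom ((β 0 ⊗ₜ[k] (1 : k)) ⊗ₜ[k] β 0)) (S.triangle R R)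
  change TensorProduct.map LinearMap.id (S.leftUnitor R).hom.hom.hom
      ((S.associator R S.unitObj R).hom.hom.hom ((β 0 ⊗ₜ[k] (1 : k)) ⊗ₜ[k] β 0)) =
    TensorProduct.map (S.rightUnitor R).hom.hom.hom LinearMap.id
      ((β 0 ⊗ₜ[k] (1 : k)) ⊗ₜ[k] β 0) at htri
  rw [TensorProduct.map_tmul, hR, hA, map_smul, TensorProduct.map_tmul, HomCat.pow_zero_apply,
    hL, one_smul, one_smul, TensorProduct.tmul_smul, ← TensorProduct.smul_tmul'] at htri
  simp only [LinearMap.id_apply, R, β, regularObj_pow_basis, smul_smul, ← Units.val_mul,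
    ← Module.Basis.tensorProduct_apply] at htri
  obtain ⟨hq, hexp'⟩ := smul_basis_inj _ htri
  simp only [Prod.mk.injEq] at hexp'
  -- With `e = 0` the unit object in the middle is untouched, so the triangle compares `f^a` with
  -- `f^n` on the left factor, and `f^(s + b)` with the identity on the right factor.
  obtain rfl : a = n := by omega
  obtain rfl : s = -b := by omega
  -- The pentagon has three associators on one side and two on the other: `p³ = p² d^(-a-b)`.
  have hp' : p = d ^ (-a - b) := by
    rw [neg_zero, zpow_zero, mul_one, mul_mul_mul_comm, ← zpow_add, ← sub_eq_add_neg] at hp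
    exact mul_left_cancel ((mul_assoc p p p).trans hp)
  subst hp'
  -- The choice `q = r * d^(-b)` makes the left unit scalar `q * d^b` equal to `r`; the right one
  -- then follows from the scalar equation of the triangle.
  refine ⟨d, r * d ^ (-b), a, b, hT, hd, fun X Y Z x y z => ?_, fun X κ x => ?_,
    fun X κ x => ?_⟩
  · rw [hA, HomCat.pow_zero_apply]
  · rw [hL, mul_assoc, ← zpow_add, neg_add_cancel, zpow_zero, mul_one]
  · rw [hR, ← hq, mul_assoc, ← zpow_add, mul_comm, neg_add_eq_sub]

end InducedMonoidal

end Classification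

/-! ### Strict monoidal functors and identity structure maps. -/

theorem HomCat.eqToHom_hom {C : Type u} [Category.{v} C] {X Y : HomCat C} (h : X = Y) :
    (eqToHom h).hom = eqToHom (congrArg HomCat.obj h) := by
  subst h; rfl

theorem LeftMod.eqToHom_hom {k : Type u} [Field k] {H : Type w} [Ring H] [Algebra k H]
    {X Y : LeftMod k H} (h : X = Y) : (eqToHom h).hom = eqToHom (congrArg LeftMod.obj h) := by
  subst h; rfl

/-- The isomorphism of `H(C)` given by the identity of an object of `C`. -/
def HomCat.idIso {C : Type u} [Category.{v} C] {M : C} {f g : M ≅ M} (h : f = g) :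
    (⟨M, f⟩ : HomCat C) ≅ ⟨M, g⟩ :=
  HomCat.mkIso (Iso.refl M) (by simp [h])

/-- The structure maps of the strict functors below are given as identities of underlying spaces, so
that coherence can be checked on elements; this shows them to be the maps required by strictness. -/
theorem HomCat.idIso_hom {C : Type u} [Category.{v} C] {M : C} {f g : M ≅ M} (h : f = g) :
    (HomCat.idIso h).hom = eqToHom (congrArg (HomCat.mk M) h) := by
  subst h; rfl

section Strict

variable {C : Type u} [Category.{v} C] {D : Type w} [Category.{v} D]

theorem isStrictMonoidal_of_iso (mC : MonoidalCategory C) (mD : MonoidalCategory D)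
    (F : C ⥤ D) (εIso : 𝟙_ D ≅ F.obj (𝟙_ C)) (μIso : ∀ X Y, F.obj X ⊗ F.obj Y ≅ F.obj (X ⊗ Y))
    (ε_eq : ∃ h, εIso.hom = eqToHom h) (μ_eq : ∀ X Y, ∃ h, (μIso X Y).hom = eqToHom h)
    (natural_left : ∀ {X Y : C} (f : X ⟶ Y) (X' : C),
      F.map f ▷ F.obj X' ≫ (μIso Y X').hom = (μIso X X').hom ≫ F.map (f ▷ X'))
    (natural_right : ∀ {X Y : C} (X' : C) (f : X ⟶ Y),
      F.obj X' ◁ F.map f ≫ (μIso X' Y).hom = (μIso X' X).hom ≫ F.map (X' ◁ f))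
    (associativity : ∀ X Y Z : C,
      (μIso X Y).hom ▷ F.obj Z ≫ (μIso (X ⊗ Y) Z).hom ≫ F.map (α_ X Y Z).hom =
        (α_ (F.obj X) (F.obj Y) (F.obj Z)).hom ≫ F.obj X ◁ (μIso Y Z).hom ≫
          (μIso X (Y ⊗ Z)).hom)
    (left_unitality : ∀ X : C, (λ_ (F.obj X)).hom =
      εIso.hom ▷ F.obj X ≫ (μIso (𝟙_ C) X).hom ≫ F.map (λ_ X).hom)
    (right_unitality : ∀ X : C, (ρ_ (F.obj X)).hom =
      F.obj X ◁ εIso.hom ≫ (μIso X (𝟙_ C)).hom ≫ F.map (ρ_ X).hom) :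
    IsStrictMonoidal mC mD F :=
  ⟨Functor.CoreMonoidal.toMonoidal
    { εIso := εIso
      μIso := μIso
      μIso_hom_natural_left := natural_left
      μIso_hom_natural_right := natural_right
      associativity := associativity
      left_unitality := left_unitality
      right_unitality := right_unitality }, ε_eq, μ_eq⟩

/-- The structure maps are determined by strictness, so compatibility with the symmetries may be
tested on the maps `eqToHom`, whichever monoidal structure on `F` witnesses strictness. -/
theorem IsStrictMonoidal.isStrictSymmetric {mC : MonoidalCategory C} {mD : MonoidalCategory D}
    {F : C ⥤ D} (h : IsStrictMonoidal mC mD F) (sC : SymmetricCategory C)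
    (sD : SymmetricCategory D)
    (braided : ∀ (X Y : C) (h₁ : F.obj X ⊗ F.obj Y = F.obj (X ⊗ Y))
      (h₂ : F.obj Y ⊗ F.obj X = F.obj (Y ⊗ X)),
      eqToHom h₁ ≫ F.map (β_ X Y).hom = (β_ (F.obj X) (F.obj Y)).hom ≫ eqToHom h₂) :
    IsStrictSymmetric sC sD F := by
  obtain ⟨m, hε, hμ⟩ := h
  exact ⟨{ toMonoidal := m
           braided := fun X Y => by
            obtain ⟨h₁, e₁⟩ := hμ X Y
            obtain ⟨h₂, e₂⟩ := hμ Y X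
            rw [e₁, e₂, braided X Y h₁ h₂] }, hε, hμ⟩

end Strict

/-! ### Uniqueness of the parameters and normalisation of the unit object. -/

section Classification

variable {k : Type u} [Field k]

namespace InducedMonoidal

theorem homStructure_hasParameters (q : kˣ) (a b : ℤ) :
    (homStructure k q a b).HasParameters 1 q a b where
  tensorAut X Y x y := by
    rw [inv_one, Units.val_one, one_smul]; rfl
  unitAut κ := by
    rw [Units.val_one, one_mul]; rfl
  associator X Y Z x y z := by
    rw [one_zpow, Units.val_one, one_smul]; rfl
  leftUnitor X κ x := by
    rw [one_zpow, mul_one]; rfl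
  rightUnitor X κ x := by
    rw [one_zpow, mul_one]; rfl

/-- On basis vectors of the regular object the associator shows `a` and `b` as exponents; for fixed
`b` and `d` the left unit constraint then shows `q` as a scalar. -/
theorem HasParameters.parameters_unique {S : InducedMonoidal (ModuleCat.{u} k)}
    {d q q' : kˣ} {a b a' b' : ℤ} (h : S.HasParameters d q a b)
    (h' : S.HasParameters d q' a' b') : q = q' ∧ a = a' ∧ b = b' := by
  have e := (h.associator _ _ _ (regularBasis k 0) (regularBasis k 0) (regularBasis k 0)).symm.trans
    (h'.associator _ _ _ (regularBasis k 0) (regularBasis k 0) (regularBasis k 0))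
  simp only [regularObj_pow_basis, ← Module.Basis.tensorProduct_apply] at e
  obtain ⟨-, e⟩ := smul_basis_inj _ e
  simp only [Prod.mk.injEq, add_zero, true_and] at e
  obtain ⟨rfl, rfl⟩ := e
  have e := (h.leftUnitor _ 1 (regularBasis k 0)).symm.trans
    (h'.leftUnitor _ 1 (regularBasis k 0))
  simp only [one_smul, regularObj_pow_basis] at e
  exact ⟨mul_right_cancel (smul_basis_inj _ e).1, rfl, rfl⟩

/-- The parameters prescribe every structure map on pure tensors, hence everywhere, and the
remaining fields are propositions. -/
theorem HasParameters.eq {S T : InducedMonoidal (ModuleCat.{u} k)} {d q : kˣ} {a b : ℤ}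
    (hS : S.HasParameters d q a b) (hT : T.HasParameters d q a b) : S = T := by
  revert hS hT
  obtain ⟨⟨tS, cS, uS⟩, αS, lS, rS, -, -, -, -, -⟩ := S
  obtain ⟨⟨tT, cT, uT⟩, αT, lT, rT, -, -, -, -, -⟩ := T
  intro hS hT
  -- The automorphisms must be identified first, since the types of the constraints depend on them.
  obtain rfl : tS = tT := by
    funext X Y
    apply Iso.ext
    apply ModuleCat.MonoidalCategory.tensor_ext
    intro x y
    exact (hS.tensorAut X Y x y).trans (hT.tensorAut X Y x y).symm
  obtain rfl : uS = uT := by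
    apply Iso.ext
    apply ModuleCat.hom_ext
    apply LinearMap.ext
    intro κ
    exact (hS.unitAut κ).trans (hT.unitAut κ).symm
  obtain rfl : αS = αT := by
    funext X Y Z
    apply Iso.ext
    apply HomCat.hom_ext
    apply ModuleCat.MonoidalCategory.tensor_ext₃'
    intro x y z
    exact (hS.associator X Y Z x y z).trans (hT.associator X Y Z x y z).symm
  obtain rfl : lS = lT := by
    funext X
    apply Iso.ext
    apply HomCat.hom_ext
    apply ModuleCat.MonoidalCategory.tensor_ext
    intro κ x
    exact (hS.leftUnitor X κ x).trans (hT.leftUnitor X κ x).symm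
  obtain rfl : rS = rT := by
    funext X
    apply Iso.ext
    apply HomCat.hom_ext
    apply ModuleCat.MonoidalCategory.tensor_ext
    intro x κ
    exact (hS.rightUnitor X κ x).trans (hT.rightUnitor X κ x).symm
  rfl

theorem existsUnique_eq_homStructure (S : InducedMonoidal (ModuleCat.{u} k))
    (hS : S.unitAut = Iso.refl _) :
    ∃! p : kˣ × ℤ × ℤ, S = homStructure k p.1 p.2.1 p.2.2 := by
  obtain ⟨d, q, a, b, h⟩ := S.exists_hasParameters
  -- `d` is the value at `1` of the automorphism of the unit object, which is the identity here.
  obtain rfl : d = 1 := by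
    have e := h.unitAut 1
    rw [hS, mul_one] at e
    exact Units.ext e.symm
  refine ⟨(q, a, b), h.eq (homStructure_hasParameters q a b), ?_⟩
  rintro ⟨q', a', b'⟩ rfl
  obtain ⟨rfl, rfl, rfl⟩ := h.parameters_unique (homStructure_hasParameters q' a' b')
  rfl

end InducedMonoidal

/-- The object `(X, d f_X)`. -/
noncomputable abbrev HomCat.scale (d : kˣ) (X : HomCat (ModuleCat.{u} k)) :
    HomCat (ModuleCat.{u} k) :=
  ⟨X.obj, (X.aut.toLinearEquiv ≪≫ₗ LinearEquiv.smulOfUnit d).toModuleIso⟩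

theorem HomCat.scale_pow (d : kˣ) (X : HomCat (ModuleCat.{u} k)) (n : ℤ) (x : X.obj) :
    (X.scale d).pow n x = ((d ^ n : kˣ) : k) • X.pow n x := by
  have h := (X.scale d).pow_orbit (fun n => ((d ^ n : kˣ) : k) • X.pow n x) (fun n => by
    change (d : k) • X.aut.hom.hom (((d ^ n : kˣ) : k) • X.pow n x) = _
    rw [map_smul, smul_smul, HomCat.pow_add_apply, HomCat.pow_one_apply, zpow_one_add,
      Units.val_mul]) n 0
  simpa using h

/-- The functor `(X, f_X) ↦ (X, d f_X)`. -/
noncomputable def scaleFunctor (d : kˣ) : HomCat (ModuleCat.{u} k) ⥤ HomCat (ModuleCat.{u} k) where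
  obj X := X.scale d
  map {X Y} f := ⟨f.hom, by
    apply ModuleCat.hom_ext
    apply LinearMap.ext
    intro x
    change f.hom ((d : k) • X.aut.hom x) = (d : k) • Y.aut.hom (f.hom x)
    rw [map_smul]
    exact congrArg ((d : k) • ·) (ConcreteCategory.congr_hom f.comm x)⟩

/-- The forgetful functor is faithful, and transport along an equality of objects is visible on
underlying objects, so morphisms need only be compared after forgetting. -/
theorem HomCat.functor_ext {D : Type w} [Category.{v} D] {C : Type u} [Category.{v} C]
    {F G : D ⥤ HomCat C} (hobj : ∀ X, F.obj X = G.obj X)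
    (hforget : F ⋙ HomCat.forget C = G ⋙ HomCat.forget C) : F = G := by
  refine CategoryTheory.Functor.ext hobj fun X Y f => ?_
  apply HomCat.hom_ext
  rw [HomCat.comp_hom, HomCat.comp_hom, HomCat.eqToHom_hom, HomCat.eqToHom_hom]
  exact CategoryTheory.Functor.congr_hom hforget f

theorem scaleFunctor_comp {d e : kˣ} (h : e * d = 1) : scaleFunctor d ⋙ scaleFunctor e = 𝟭 _ := by
  refine HomCat.functor_ext (fun X => ?_) rfl
  change (⟨X.obj, _⟩ : HomCat (ModuleCat.{u} k)) = ⟨X.obj, X.aut⟩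
  congr 1
  apply Iso.ext
  apply ModuleCat.hom_ext
  apply LinearMap.ext
  intro x
  change (e : k) • (d : k) • X.aut.hom.hom x = X.aut.hom.hom x
  rw [smul_smul, ← Units.val_mul, h, Units.val_one, one_smul]

theorem scaleFunctor_isCategoryIso (d : kˣ) : IsCategoryIso (scaleFunctor d) :=
  ⟨scaleFunctor d⁻¹, scaleFunctor_comp (inv_mul_cancel d), scaleFunctor_comp (mul_inv_cancel d)⟩

namespace InducedMonoidal

/-- Rescaling by `d⁻¹` makes the unit automorphism the identity. The tensor product is preserved
because `d⁻¹ (d⁻¹ f_X ⊗ f_Y) = (d⁻¹ f_X) ⊗ (d⁻¹ f_Y)`, and powers of `d⁻¹ f_X` absorb the powers of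
`d` in the constraints. -/
theorem HasParameters.isStrictMonoidal {S : InducedMonoidal (ModuleCat.{u} k)} {d q : kˣ}
    {a b : ℤ} (h : S.HasParameters d q a b) :
    IsStrictMonoidal S.monoidalCategory (homStructure k q a b).monoidalCategory
      (scaleFunctor d⁻¹) := by
  have hμ : ∀ X Y : HomCat (ModuleCat.{u} k),
      (diagonalTensor _).tensorAut (X.scale d⁻¹) (Y.scale d⁻¹) =
        ((S.tensorObj X Y).scale d⁻¹).aut := fun X Y => by
    apply Iso.ext
    apply ModuleCat.MonoidalCategory.tensor_ext
    intro (x : X.obj) (y : Y.obj)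
    change (((d⁻¹ : kˣ) : k) • X.aut.hom.hom x) ⊗ₜ[k] (((d⁻¹ : kˣ) : k) • Y.aut.hom.hom y) =
      ((d⁻¹ : kˣ) : k) • (S.tensorAut X Y).hom.hom (x ⊗ₜ[k] y)
    rw [h.tensorAut, ← TensorProduct.smul_tmul', TensorProduct.tmul_smul]
  have hε : (diagonalTensor (ModuleCat.{u} k)).unitAut = (S.unitObj.scale d⁻¹).aut := by
    apply Iso.ext
    apply ModuleCat.hom_ext
    apply LinearMap.ext
    intro κ
    change κ = ((d⁻¹ : kˣ) : k) • S.unitAut.hom.hom κ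
    rw [h.unitAut]
    exact (inv_smul_smul d (κ : k)).symm
  refine isStrictMonoidal_of_iso _ _ _ (HomCat.idIso hε) (fun X Y => HomCat.idIso (hμ X Y))
    ⟨_, HomCat.idIso_hom hε⟩ (fun X Y => ⟨_, HomCat.idIso_hom (hμ X Y)⟩) (fun _ _ => rfl)
    (fun _ _ => rfl) (fun X Y Z => ?_) (fun X => ?_) (fun X => ?_)
  · apply HomCat.hom_ext
    apply ModuleCat.MonoidalCategory.tensor_ext₃'
    intro (x : X.obj) (y : Y.obj) (z : Z.obj)
    change (S.associator X Y Z).hom.hom.hom ((x ⊗ₜ[k] y) ⊗ₜ[k] z) =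
      ((X.scale d⁻¹).pow a x ⊗ₜ[k] (y ⊗ₜ[k] (Z.scale d⁻¹).pow b z) :
        X.obj ⊗[k] (Y.obj ⊗[k] Z.obj))
    rw [h.associator, HomCat.scale_pow, HomCat.scale_pow, TensorProduct.tmul_smul,
      TensorProduct.tmul_smul, ← TensorProduct.smul_tmul', smul_smul, ← Units.val_mul,
      inv_zpow', inv_zpow', ← zpow_add, neg_add_eq_sub, neg_sub_comm]
  · apply HomCat.hom_ext
    apply ModuleCat.MonoidalCategory.tensor_ext
    intro (κ : k) (x : X.obj)
    change (q : k) • (X.scale d⁻¹).pow (-b) (κ • x) =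
      (S.leftUnitor X).hom.hom.hom (κ ⊗ₜ[k] x)
    rw [h.leftUnitor, HomCat.scale_pow, smul_smul, ← Units.val_mul, inv_zpow', neg_neg]
  · apply HomCat.hom_ext
    apply ModuleCat.MonoidalCategory.tensor_ext
    intro (x : X.obj) (κ : k)
    change (q : k) • (X.scale d⁻¹).pow a (κ • x) =
      (S.rightUnitor X).hom.hom.hom (x ⊗ₜ[k] κ)
    rw [h.rightUnitor, HomCat.scale_pow, smul_smul, ← Units.val_mul, inv_zpow']

theorem exists_isomorphic_homStructure (S : InducedMonoidal (ModuleCat.{u} k)) :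
    ∃ (q : kˣ) (a b : ℤ), S.Isomorphic (homStructure k q a b) := by
  obtain ⟨d, q, a, b, h⟩ := S.exists_hasParameters
  exact ⟨q, a, b, scaleFunctor d⁻¹, scaleFunctor_isCategoryIso _, rfl, h.isStrictMonoidal⟩

end InducedMonoidal

end Classification

/-! ### Existence and uniqueness of the braiding. -/

section Braiding

variable {k : Type u} [Field k]

theorem HomCat.pow_symm_apply (X : HomCat (ModuleCat.{u} k)) (n : ℤ) (x : X.obj) :
    (X.pow n).symm x = X.pow (-n) x := by
  rw [LinearEquiv.symm_apply_eq, ← HomCat.pow_add_apply, add_neg_cancel, HomCat.pow_zero_apply]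

/-- The map `x ⊗ y ↦ f_Y^{-a-b} y ⊗ f_X^{a+b} x`. -/
noncomputable def homBraiding (a b : ℤ) (X Y : HomCat (ModuleCat.{u} k)) :
    (diagonalTensor _).tensorObj X Y ≅ (diagonalTensor _).tensorObj Y X :=
  HomCat.mkIso ((TensorProduct.comm k X.obj Y.obj ≪≫ₗ
    TensorProduct.congr (Y.pow (-a - b)) (X.pow (a + b))).toModuleIso) (by
      apply ModuleCat.MonoidalCategory.tensor_ext
      intro x y
      change Y.pow (-a - b) (Y.aut.hom y) ⊗ₜ[k] X.pow (a + b) (X.aut.hom x) =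
        Y.aut.hom (Y.pow (-a - b) y) ⊗ₜ[k] X.aut.hom (X.pow (a + b) x)
      simp only [← HomCat.pow_one_apply]
      rw [HomCat.pow_comm_apply X, HomCat.pow_comm_apply Y])

theorem homBraiding_naturality (a b : ℤ) {X X' Y Y' : HomCat (ModuleCat.{u} k)} (f : X ⟶ X')
    (g : Y ⟶ Y') : (diagonalTensor _).tensorHom f g ≫ (homBraiding a b X' Y').hom =
      (homBraiding a b X Y).hom ≫ (diagonalTensor _).tensorHom g f := by
  apply HomCat.hom_ext
  apply ModuleCat.MonoidalCategory.tensor_ext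
  intro x y
  change Y'.pow (-a - b) (g.hom y) ⊗ₜ[k] X'.pow (a + b) (f.hom x) =
    g.hom (Y.pow (-a - b) y) ⊗ₜ[k] f.hom (X.pow (a + b) x)
  rw [HomCat.hom_pow_apply, HomCat.hom_pow_apply]

theorem homBraiding_hexagon_forward (q : kˣ) (a b : ℤ) (X Y Z : HomCat (ModuleCat.{u} k)) :
    ((homStructure k q a b).associator X Y Z).hom ≫
        (homBraiding a b X ((diagonalTensor _).tensorObj Y Z)).hom ≫
          ((homStructure k q a b).associator Y Z X).hom =
      (diagonalTensor _).tensorHom (homBraiding a b X Y).hom (𝟙 Z) ≫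
        ((homStructure k q a b).associator Y X Z).hom ≫
          (diagonalTensor _).tensorHom (𝟙 Y) (homBraiding a b X Z).hom := by
  apply HomCat.hom_ext
  apply ModuleCat.MonoidalCategory.tensor_ext₃'
  intro x y z
  change TensorProduct.congr (Y.pow a) (TensorProduct.congr (LinearEquiv.refl k Z.obj) (X.pow b))
      (TensorProduct.assoc k Y.obj Z.obj X.obj
        ((((diagonalTensor _).tensorObj Y Z).pow (-a - b)
          (y ⊗ₜ[k] Z.pow b z : (Y.obj ⊗ Z.obj : ModuleCat k))) ⊗ₜ[k]
            X.pow (a + b) (X.pow a x))) =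
    Y.pow a (Y.pow (-a - b) y) ⊗ₜ[k] (Z.pow (-a - b) (Z.pow b z) ⊗ₜ[k]
      X.pow (a + b) (X.pow (a + b) x))
  rw [diagonalTensor_pow_tmul]
  change Y.pow a (Y.pow (-a - b) y) ⊗ₜ[k] (Z.pow (-a - b) (Z.pow b z) ⊗ₜ[k]
    X.pow b (X.pow (a + b) (X.pow a x))) = _
  simp only [← HomCat.pow_add_apply]
  -- Only the exponent on `X` needs rearranging: two associators and one braiding on one side, two
  -- braidings on the other. In the reverse hexagon the same happens with `Z`.
  rw [show b + (a + b + a) = a + b + (a + b) by ring]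

theorem homBraiding_hexagon_reverse (q : kˣ) (a b : ℤ) (X Y Z : HomCat (ModuleCat.{u} k)) :
    ((homStructure k q a b).associator X Y Z).inv ≫
        (homBraiding a b ((diagonalTensor _).tensorObj X Y) Z).hom ≫
          ((homStructure k q a b).associator Z X Y).inv =
      (diagonalTensor _).tensorHom (𝟙 X) (homBraiding a b Y Z).hom ≫
        ((homStructure k q a b).associator X Z Y).inv ≫
          (diagonalTensor _).tensorHom (homBraiding a b X Z).hom (𝟙 Y) := by
  apply HomCat.hom_ext
  apply ModuleCat.MonoidalCategory.tensor_ext₃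
  intro x y z
  change (TensorProduct.assoc k Z.obj X.obj Y.obj).symm
      ((TensorProduct.congr (Z.pow a)
        (TensorProduct.congr (LinearEquiv.refl k X.obj) (Y.pow b))).symm
        (Z.pow (-a - b) ((Z.pow b).symm z) ⊗ₜ[k]
          (((diagonalTensor _).tensorObj X Y).pow (a + b)
            ((X.pow a).symm x ⊗ₜ[k] y : (X.obj ⊗ Y.obj : ModuleCat k))))) =
    (Z.pow (-a - b) (Z.pow (-a - b) z) ⊗ₜ[k] X.pow (a + b) ((X.pow a).symm x)) ⊗ₜ[k]
      (Y.pow b).symm (Y.pow (a + b) y)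
  rw [diagonalTensor_pow_tmul]
  change ((Z.pow a).symm (Z.pow (-a - b) ((Z.pow b).symm z)) ⊗ₜ[k]
    X.pow (a + b) ((X.pow a).symm x)) ⊗ₜ[k] (Y.pow b).symm (Y.pow (a + b) y) = _
  simp only [HomCat.pow_symm_apply, ← HomCat.pow_add_apply]
  rw [show -a + (-a - b + -b) = -a - b + (-a - b) by ring]

theorem homBraiding_symmetry (a b : ℤ) (X Y : HomCat (ModuleCat.{u} k)) :
    (homBraiding a b X Y).hom ≫ (homBraiding a b Y X).hom = 𝟙 _ := by
  apply HomCat.hom_ext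
  apply ModuleCat.MonoidalCategory.tensor_ext
  intro x y
  change X.pow (-a - b) (X.pow (a + b) x) ⊗ₜ[k] Y.pow (a + b) (Y.pow (-a - b) y) = x ⊗ₜ[k] y
  rw [← HomCat.pow_add_apply, ← HomCat.pow_add_apply, show -a - b + (a + b) = 0 by ring,
    show a + b + (-a - b) = 0 by ring, HomCat.pow_zero_apply, HomCat.pow_zero_apply]

/-- The symmetry of `H^{a,b}_q(Vect)`. -/
@[reducible]
noncomputable def homSymmetricCategory (q : kˣ) (a b : ℤ) :
    @SymmetricCategory (HomCat (ModuleCat.{u} k)) _ (homStructure k q a b).monoidalCategory :=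
  letI := (homStructure k q a b).monoidalCategory
  { braiding := homBraiding a b
    braiding_naturality_right := fun X _ _ f => homBraiding_naturality a b (𝟙 X) f
    braiding_naturality_left := fun f Z => homBraiding_naturality a b f (𝟙 Z)
    hexagon_forward := homBraiding_hexagon_forward q a b
    hexagon_reverse := homBraiding_hexagon_reverse q a b
    symmetry := homBraiding_symmetry a b }

/-- Naturality leaves a scalar `c` and exponents `i, j`. The forward hexagon gives `i + a + b = 2i`
for the object moved past the others, and `c = c²`, as it has one braiding on one side and two on
the other. The reverse hexagon gives `j - a - b = 2j`. -/
theorem homStructure_braiding_apply (q : kˣ) (a b : ℤ)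
    (B : @BraidedCategory (HomCat (ModuleCat.{u} k)) _ (homStructure k q a b).monoidalCategory)
    (X Y : HomCat (ModuleCat.{u} k)) (x : X.obj) (y : Y.obj) :
    (B.braiding X Y).hom.hom.hom (x ⊗ₜ[k] y) =
      (Y.pow (-a - b) y ⊗ₜ[k] X.pow (a + b) x : Y.obj ⊗[k] X.obj) := by
  obtain ⟨c, i, j, h⟩ := exists_natural_tmul_eq
    -- The flip brings the braiding back to `X ⊗ Y`, where the classification of natural
    -- automorphisms applies.
    (fun X Y => ((HomCat.forget _).mapIso (B.braiding X Y)).toLinearEquiv ≪≫ₗ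
      TensorProduct.comm k Y.obj X.obj)
    (fun {X X' Y Y'} f g t => by
      have e := congrArg (fun φ => φ.hom.hom t) (@BraidedCategory.braiding_naturality _ _
        (homStructure k q a b).monoidalCategory B _ _ _ _ f g)
      refine (congrArg (TensorProduct.comm k Y'.obj X'.obj) e).trans ?_
      exact (TensorProduct.map_comm f.hom.hom g.hom.hom _).symm)
  have hc : ∀ (X Y : HomCat (ModuleCat.{u} k)) (x : X.obj) (y : Y.obj),
      (B.braiding X Y).hom.hom.hom (x ⊗ₜ[k] y) =
        (c : k) • (Y.pow j y ⊗ₜ[k] X.pow i x : Y.obj ⊗[k] X.obj) := fun X Y x y => by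
    apply (TensorProduct.comm k Y.obj X.obj).injective
    rw [map_smul]
    exact h X Y x y
  let R := regularObj k
  set β := regularBasis k
  let R₂ := (diagonalTensor _).tensorObj R R
  have c₁ : ∀ x y z : R.obj, (B.braiding R R₂).hom.hom.hom (x ⊗ₜ[k] (y ⊗ₜ[k] z)) =
      (c : k) • ((R.pow j y ⊗ₜ[k] R.pow j z) ⊗ₜ[k] R.pow i x :
        (R.obj ⊗[k] R.obj) ⊗[k] R.obj) := fun x y z => by
    refine (hc R R₂ x (y ⊗ₜ[k] z)).trans ?_
    rw [diagonalTensor_pow_tmul]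
  have c₂ : ∀ x y z : R.obj, (B.braiding R₂ R).hom.hom.hom ((x ⊗ₜ[k] y) ⊗ₜ[k] z) =
      (c : k) • (R.pow j z ⊗ₜ[k] (R.pow i x ⊗ₜ[k] R.pow i y) :
        R.obj ⊗[k] (R.obj ⊗[k] R.obj)) := fun x y z => by
    refine (hc R₂ R (x ⊗ₜ[k] y) z).trans ?_
    rw [diagonalTensor_pow_tmul]
  have hα : ∀ x y z : R.obj, ((homStructure k q a b).associator R R R).hom.hom.hom
      ((x ⊗ₜ[k] y) ⊗ₜ[k] z) = (R.pow a x ⊗ₜ[k] (y ⊗ₜ[k] R.pow b z) :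
        R.obj ⊗[k] (R.obj ⊗[k] R.obj)) := fun x y z => rfl
  have hα' : ∀ x y z : R.obj, ((homStructure k q a b).associator R R R).inv.hom.hom
      (x ⊗ₜ[k] (y ⊗ₜ[k] z)) = ((R.pow (-a) x ⊗ₜ[k] y) ⊗ₜ[k] R.pow (-b) z :
        (R.obj ⊗[k] R.obj) ⊗[k] R.obj) := fun x y z => by
    rw [← HomCat.pow_symm_apply, ← HomCat.pow_symm_apply]
    rfl
  have hf : ((homStructure k q a b).associator R R R).hom.hom.hom
      ((B.braiding R R₂).hom.hom.hom (((homStructure k q a b).associator R R R).hom.hom.hom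
        ((β 0 ⊗ₜ[k] β 0) ⊗ₜ[k] β 0))) =
      TensorProduct.map LinearMap.id (B.braiding R R).hom.hom.hom
        (((homStructure k q a b).associator R R R).hom.hom.hom
          (TensorProduct.map (B.braiding R R).hom.hom.hom LinearMap.id
            ((β 0 ⊗ₜ[k] β 0) ⊗ₜ[k] β 0))) :=
    congrArg (fun φ => φ.hom.hom ((β 0 ⊗ₜ[k] β 0) ⊗ₜ[k] β 0)) (B.hexagon_forward R R R)
  have hr : ((homStructure k q a b).associator R R R).inv.hom.hom
      ((B.braiding R₂ R).hom.hom.hom (((homStructure k q a b).associator R R R).inv.hom.hom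
        (β 0 ⊗ₜ[k] (β 0 ⊗ₜ[k] β 0)))) =
      TensorProduct.map (B.braiding R R).hom.hom.hom LinearMap.id
        (((homStructure k q a b).associator R R R).inv.hom.hom
          (TensorProduct.map LinearMap.id (B.braiding R R).hom.hom.hom
            (β 0 ⊗ₜ[k] (β 0 ⊗ₜ[k] β 0)))) :=
    congrArg (fun φ => φ.hom.hom (β 0 ⊗ₜ[k] (β 0 ⊗ₜ[k] β 0))) (B.hexagon_reverse R R R)
  rw [hα, c₁, map_smul, hα, TensorProduct.map_tmul, hc, ← TensorProduct.smul_tmul', map_smul, hα,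
    map_smul, TensorProduct.map_tmul, hc, TensorProduct.tmul_smul] at hf
  rw [hα', c₂, map_smul, hα', TensorProduct.map_tmul, hc, TensorProduct.tmul_smul, map_smul, hα',
    map_smul, TensorProduct.map_tmul, hc, ← TensorProduct.smul_tmul'] at hr
  simp only [LinearMap.id_apply, R, β, regularObj_pow_basis, smul_smul, ← Units.val_mul,
    ← Module.Basis.tensorProduct_apply] at hf hr
  obtain ⟨hc1, hf⟩ := smul_basis_inj _ hf
  obtain ⟨-, hr⟩ := smul_basis_inj _ hr
  simp only [Prod.mk.injEq] at hf hr
  obtain rfl : i = a + b := by omega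
  obtain rfl : j = -a - b := by omega
  obtain rfl : c = 1 := left_eq_mul.1 hc1
  rw [hc, Units.val_one, one_smul]

theorem homStructure_braidedCategory_eq (q : kˣ) (a b : ℤ)
    (B B' : @BraidedCategory (HomCat (ModuleCat.{u} k)) _
      (homStructure k q a b).monoidalCategory) : B = B' := by
  have h : B.braiding = B'.braiding := by
    funext X Y
    apply Iso.ext
    apply HomCat.hom_ext
    apply ModuleCat.MonoidalCategory.tensor_ext
    intro x y
    exact (homStructure_braiding_apply q a b B X Y x y).trans
      (homStructure_braiding_apply q a b B' X Y x y).symm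
  cases B
  cases B'
  congr 1

end Braiding

/-! ### Modules over the group algebra and the functor `W`. -/

section FunctorW

variable {k : Type u} [Field k]

/-- The object `W(X)`. -/
noncomputable abbrev LeftMod.toHomCat (X : LeftMod k (CyclicGroupAlgebra k)) :
    HomCat (ModuleCat.{u} k) := ⟨X.obj, (actUnit X.act (genPow k 1)).toModuleIso⟩

/-- This is the dictionary by which `φ`, `λ`, `ρ` and `R`, all built from powers of `g`, become the
constraints on the side of the Hom-category. -/
theorem LeftMod.toHomCat_pow (X : LeftMod k (CyclicGroupAlgebra k)) (n : ℤ) (x : X.obj) :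
    X.toHomCat.pow n x = X.act (genPow k n : CyclicGroupAlgebra k) x := by
  have h := X.toHomCat.pow_orbit (fun n => X.act (genPow k n : CyclicGroupAlgebra k) x)
    (fun n => by
      change X.act (genPow k 1 : CyclicGroupAlgebra k)
        (X.act (genPow k n : CyclicGroupAlgebra k) x) = _
      rw [genPow_add, Units.val_mul, map_mul]
      rfl) n 0
  simpa [genPow_zero] using h

/-- The module over the group algebra on which the generator acts by `f_X`. -/
noncomputable abbrev HomCat.toLeftMod (X : HomCat (ModuleCat.{u} k)) :
    LeftMod k (CyclicGroupAlgebra k) :=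
  ⟨X.obj, MonoidAlgebra.lift k (Module.End k X.obj) (Multiplicative ℤ)
    { toFun := fun n => (X.pow n.toAdd).toLinearMap
      map_one' := LinearMap.ext fun x => X.pow_zero_apply x
      map_mul' := fun m n => LinearMap.ext fun x => X.pow_add_apply m.toAdd n.toAdd x }⟩

theorem HomCat.toLeftMod_act_of (X : HomCat (ModuleCat.{u} k)) (n : Multiplicative ℤ) (x : X.obj) :
    X.toLeftMod.act (MonoidAlgebra.of k _ n) x = X.pow n.toAdd x := by
  change MonoidAlgebra.lift k (Module.End k X.obj) (Multiplicative ℤ) _ _ x = _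
  rw [MonoidAlgebra.lift_of]
  rfl

/-- The inverse of the functor `W`. -/
noncomputable def functorWInv (k : Type u) [Field k] :
    HomCat (ModuleCat.{u} k) ⥤ LeftMod k (CyclicGroupAlgebra k) where
  obj X := X.toLeftMod
  map {X Y} f := ⟨f.hom, fun h x => by
    -- Commuting with `f_X` gives commuting with all its powers, and the powers of `g` span the
    -- group algebra.
    induction h using MonoidAlgebra.induction_on with
    | of n =>
      rw [HomCat.toLeftMod_act_of, HomCat.toLeftMod_act_of]
      exact HomCat.hom_pow_apply f _ x
    | add h h' e e' => simp only [map_add, LinearMap.add_apply, e, e']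
    | smul c h e => simp only [map_smul, LinearMap.smul_apply, e]⟩

theorem functorW_isCategoryIso : IsCategoryIso (functorW k) := by
  refine ⟨functorWInv k, ?_, ?_⟩
  · have hobj : ∀ X : LeftMod k (CyclicGroupAlgebra k),
        (functorW k ⋙ functorWInv k).obj X = (𝟭 _ : _ ⥤ LeftMod k _).obj X := fun X => by
      obtain ⟨M, act⟩ := X
      change LeftMod.mk M _ = ⟨M, act⟩
      congr 1
      -- An action of the group algebra is determined by its restriction to the group, by the
      -- universal property.
      apply (MonoidAlgebra.lift k (Module.End k M) (Multiplicative ℤ)).symm.injective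
      refine MonoidHom.ext fun n => LinearMap.ext fun x => ?_
      exact (HomCat.toLeftMod_act_of (LeftMod.toHomCat ⟨M, act⟩) n x).trans
        (LeftMod.toHomCat_pow ⟨M, act⟩ n.toAdd x)
    refine CategoryTheory.Functor.ext hobj fun X Y f => ?_
    apply LeftMod.hom_ext
    rw [LeftMod.comp_hom, LeftMod.comp_hom, LeftMod.eqToHom_hom, LeftMod.eqToHom_hom]
    rfl
  · refine HomCat.functor_ext (fun X => ?_) rfl
    change (⟨X.obj, _⟩ : HomCat (ModuleCat.{u} k)) = ⟨X.obj, X.aut⟩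
    congr 1
    apply Iso.ext
    apply ModuleCat.hom_ext
    apply LinearMap.ext
    intro x
    exact (HomCat.toLeftMod_act_of X _ x).trans (X.pow_one_apply x)

/-- The products are preserved because `g` is grouplike, and the unit object because `ε(g) = 1`. The
scalar `q` in `λ` and `ρ` acts through the algebra map. -/
theorem functorW_isStrictMonoidal (q : kˣ) (a b : ℤ) :
    IsStrictMonoidal (cyclicQuasiBialgebra k q a b).monoidalCategory
      (homStructure k q a b).monoidalCategory (functorW k) := by
  let Q := cyclicQuasiBialgebra k q a b
  have hμ : ∀ X Y : LeftMod k (CyclicGroupAlgebra k),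
      (diagonalTensor _).tensorAut X.toHomCat Y.toHomCat = (Q.tensorObj X Y).toHomCat.aut :=
    fun X Y => by
      apply Iso.ext
      apply ModuleCat.MonoidalCategory.tensor_ext
      intro (x : X.obj) (y : Y.obj)
      change X.act (genPow k 1 : CyclicGroupAlgebra k) x ⊗ₜ[k]
          Y.act (genPow k 1 : CyclicGroupAlgebra k) y =
        actTensor X.act Y.act
          (CoalgebraStruct.comul (R := k) (genPow k 1 : CyclicGroupAlgebra k)) (x ⊗ₜ[k] y)
      rw [comul_genPow, actTensor_tmul_tmul]
  have hε : (diagonalTensor (ModuleCat.{u} k)).unitAut = Q.unitObj.toHomCat.aut := by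
    apply Iso.ext
    apply ModuleCat.hom_ext
    apply LinearMap.ext
    intro (κ : k)
    change κ = Algebra.ofId k (Module.End k k)
      (CoalgebraStruct.counit (R := k) (genPow k 1 : CyclicGroupAlgebra k)) κ
    rw [counit_genPow, map_one]
    rfl
  refine isStrictMonoidal_of_iso _ _ _ (HomCat.idIso hε) (fun X Y => HomCat.idIso (hμ X Y))
    ⟨_, HomCat.idIso_hom hε⟩ (fun X Y => ⟨_, HomCat.idIso_hom (hμ X Y)⟩) (fun _ _ => rfl)
    (fun _ _ => rfl) (fun X Y Z => ?_) (fun X => ?_) (fun X => ?_)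
  · apply HomCat.hom_ext
    apply ModuleCat.MonoidalCategory.tensor_ext₃'
    intro (x : X.obj) (y : Y.obj) (z : Z.obj)
    change (X.act (genPow k a : CyclicGroupAlgebra k) x ⊗ₜ[k] (Y.act 1 y ⊗ₜ[k]
        Z.act (genPow k b : CyclicGroupAlgebra k) z) : X.obj ⊗[k] (Y.obj ⊗[k] Z.obj)) =
      X.toHomCat.pow a x ⊗ₜ[k] (y ⊗ₜ[k] Z.toHomCat.pow b z)
    rw [LeftMod.toHomCat_pow, LeftMod.toHomCat_pow, map_one]
    rfl
  · apply HomCat.hom_ext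
    apply ModuleCat.MonoidalCategory.tensor_ext
    intro (κ : k) (x : X.obj)
    change (q : k) • X.toHomCat.pow (-b) (κ • x) =
      X.act (algebraMap k _ (q : k) * (genPow k (-b) : CyclicGroupAlgebra k)) (κ • x)
    rw [LeftMod.toHomCat_pow, ← Algebra.smul_def, map_smul X.act (q : k)]
    rfl
  · apply HomCat.hom_ext
    apply ModuleCat.MonoidalCategory.tensor_ext
    intro (x : X.obj) (κ : k)
    change (q : k) • X.toHomCat.pow a (κ • x) =
      X.act (algebraMap k _ (q : k) * (genPow k a : CyclicGroupAlgebra k)) (κ • x)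
    rw [LeftMod.toHomCat_pow, ← Algebra.smul_def, map_smul X.act (q : k)]
    rfl

theorem functorW_isStrictSymmetric (q : kˣ) (a b : ℤ) :
    IsStrictSymmetric (cyclicSymmetricCategory k q a b) (homSymmetricCategory q a b)
      (functorW k) := by
  refine (functorW_isStrictMonoidal q a b).isStrictSymmetric _ _ fun X Y h₁ h₂ => ?_
  apply HomCat.hom_ext
  have e₁ := HomCat.eqToHom_hom h₁
  have e₂ := HomCat.eqToHom_hom h₂
  -- The two `eqToHom` are identities on underlying spaces; what remains compares the action of `R`
  -- followed by the flip with the braiding of the Hom-category.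
  refine (congrArg (· ≫ _) e₁).trans (Eq.trans ?_ (congrArg (_ ≫ ·) e₂).symm)
  apply ModuleCat.MonoidalCategory.tensor_ext
  intro (x : X.obj) (y : Y.obj)
  change (Y.act (genPow k (-a - b) : CyclicGroupAlgebra k) y ⊗ₜ[k]
      X.act (genPow k (a + b) : CyclicGroupAlgebra k) x : Y.obj ⊗[k] X.obj) =
    Y.toHomCat.pow (-a - b) y ⊗ₜ[k] X.toHomCat.pow (a + b) x
  rw [LeftMod.toHomCat_pow, LeftMod.toHomCat_pow]

end FunctorW

theorem mainTheorem9 (k : Type u) [Field k] :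
    (∀ S : InducedMonoidal (ModuleCat.{u} k), ∃ (q : kˣ) (a b : ℤ),
      S.Isomorphic (homStructure k q a b)) ∧
    (∀ S : InducedMonoidal (ModuleCat.{u} k), S.unitAut = Iso.refl _ →
      ∃! p : kˣ × ℤ × ℤ, S = homStructure k p.1 p.2.1 p.2.2) ∧
    ∀ (q : kˣ) (a b : ℤ),
      ∃ B : @SymmetricCategory (HomCat (ModuleCat.{u} k)) _
          (homStructure k q a b).monoidalCategory,
        (∀ B' : @BraidedCategory (HomCat (ModuleCat.{u} k)) _
          (homStructure k q a b).monoidalCategory, B' = B.toBraidedCategory) ∧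
        (∀ (X Y : HomCat (ModuleCat.{u} k)) (x : X.obj) (y : Y.obj),
          (B.braiding X Y).hom.hom (x ⊗ₜ[k] y) = Y.pow (-a - b) y ⊗ₜ[k] X.pow (a + b) x) ∧
        IsCategoryIso (functorW k) ∧
        IsStrictSymmetric (cyclicSymmetricCategory k q a b) B (functorW k) :=
  ⟨InducedMonoidal.exists_isomorphic_homStructure,
    InducedMonoidal.existsUnique_eq_homStructure, fun q a b =>
      ⟨homSymmetricCategory q a b, fun _ => homStructure_braidedCategory_eq q a b _ _,
        fun _ _ _ _ => rfl, functorW_isCategoryIso, functorW_isStrictSymmetric q a b⟩⟩
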